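/- Let $n\ge 1$ be an integer, let $p$ be an odd prime, let $\mathbb F$ be a field, and let $$V_{8n}=\langle a,b \mid a^{2n}=b^4=1,\ ba=a^{-1}b^{-1},\ b^{-1}a=a^{-1}b\rangle .$$ Let $\mathrm{Der}_{\mathbb F}(\mathbb FV_{8n})$ be the $\mathbb F$-vector space of all $\mathbb F$-linear maps $d:\mathbb FV_{8n}\to\mathbb FV_{8n}$ with $d(xy)=d(x)y+x\,d(y)$ for all $x,y$. For $u,v\in\mathbb FV_{8n}$ write $d_{(u,v)}$ for the element $d$ of $\mathrm{Der}_{\mathbb F}(\mathbb FV_{8n})$ with $d(a)=u$ and $d(b)=v$, when it exists (it is then unique). (i) Suppose that $\operatorname{char}\mathbb F=0$, or that $\operatorname{char}\mathbb F=p$ and $\gcd(n,p)=1$. Then $\dim_{\mathbb F}\mathrm{Der}_{\mathbb F}(\mathbb FV_{8n})$ is $3(2n-1)$ if $n$ is odd and $6(n-1)$ if $n$ is even. Moreover $d_{(u,v)}$ exists for every $(u,v)\in B_1\cup B_2\cup B_3\cup B_4$, and $\mathcal B=\{d_{(u,v)} \mid (u,v)\in B_1\cup B_2\cup B_3\cup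 B_4\}$ is a basis of $\mathrm{Der}_{\mathbb F}(\mathbb FV_{8n})$, where $$\begin{aligned} B_1=\{&((a^{-2k}-a^{2k})b,\,0),\ ((a^{2k-1}-a^{-(2k+1)})b,\ a^{2k}-a^{-2k}),\ ((a^{-2k}-a^{2k})b^3,\,0),\\ &((a^{2k-1}-a^{-(2k+1)})b^3,\ (a^{2k}-a^{-2k})b^2),\ (0,\,(a^{2k}-a^{-2k})b),\ (0,\,(a^{2k}-a^{-2k})b^3) \mid 1\le k\le\lfloor\tfrac{n-1}{2}\rfloor\},\\ B_2=\{&((a^{2k-2}-a^{-2k}b^2)b,\ a^{2k-1}-a^{-(2k-1)}b^2),\ (0,\,(a^{2k-1}-a^{-(2k-1)}b^2)b) \mid 1\le k\le\lfloor\tfrac{n+1}{2}\rfloor\},\\ B_3=\{&((a^{-2k}-a^{2k-2}b^2)b,\ a^{-(2k-1)}-a^{2k-1}b^2),\ (0,\,(a^{-(2k-1)}-a^{2k-1}b^2)b) \mid 1\le k\le\lceil\tfrac{n-1}{2}\rceil\},\\ B_4=\{&((a^{-(2k-1)}-a^{2k-1}b^2)b,\,0) \mid 1\le k\le n\}. \end{aligned}$$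 (ii) Suppose that $\operatorname{char}\mathbb F=p$ and $p\mid n$. Then $\dim_{\mathbb F}\mathrm{Der}_{\mathbb F}(\mathbb FV_{8n})$ is $4(2n-1)$ if $n$ is odd and $8(n-1)$ if $n$ is even. Moreover $d_{(u,v)}$ exists for every $(u,v)\in B_1'\cup B_2'\cup B_3'\cup B_4'$, and $\mathcal B'=\{d_{(u,v)} \mid (u,v)\in B_1'\cup B_2'\cup B_3'\cup B_4'\}$ is a basis of $\mathrm{Der}_{\mathbb F}(\mathbb FV_{8n})$, where $$\begin{aligned} B_1'=\{&((a^{2k-1}-a^{-(2k+1)})b,\ a^{2k}-a^{-2k}),\ (a^{2k+1}-a^{-(2k-1)},\ (a^{2k}-a^{-2k})b),\\ &((a^{2k-1}-a^{-(2k+1)})b^3,\ (a^{2k}-a^{-2k})b^2),\ ((a^{2k+1}-a^{-(2k-1)})b^2,\ (a^{2k}-a^{-2k})b^3),\\ &((a^{-2k}-a^{2k})b^3,\,0),\ ((a^{-2k}-a^{2k})b,\,0),\ ((a^{-(2k-1)}-a^{2k+1})b^2,\,0),\ (a^{-(2k-1)}-a^{2k+1},\,0) \mid 1\le k\le\lfloor\tfrac{n-1}{2}\rfloor\},\\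 B_2'=\{&((a^{2k-2}-a^{-2k}b^2)b,\ a^{2k-1}-a^{-(2k-1)}b^2),\ (a^{2k}-a^{-(2k-2)}b^2,\ (a^{2k-1}-a^{-(2k-1)}b^2)b) \mid 1\le k\le\lfloor\tfrac{n+1}{2}\rfloor\},\\ B_3'=\{&((a^{-2k}-a^{2k-2}b^2)b,\ a^{-(2k-1)}-a^{2k-1}b^2),\ (a^{-(2k-2)}-a^{2k}b^2,\ (a^{-(2k-1)}-a^{2k-1}b^2)b) \mid 1\le k\le\lceil\tfrac{n-1}{2}\rceil\},\\ B_4'=\{&((a^{-(2k-1)}-a^{2k-1}b^2)b,\,0),\ (a^{-(2k-2)}-a^{2k}b^2,\,0) \mid 1\le k\le n\}. \end{aligned}$$ -/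

import Mathlib

namespace V8n

/-- The two generators. -/
inductive Gen
  | a
  | b

/-- The relators of `⟨a, b ∣ a^(2n) = b^4 = 1, ba = a⁻¹b⁻¹, b⁻¹a = a⁻¹b⟩`;
an equation `u = v` is encoded as the relator `u * v⁻¹`. -/
def relators (n : ℕ) : Set (FreeGroup Gen) :=
  let a := FreeGroup.of Gen.a
  let b := FreeGroup.of Gen.b
  {a ^ (2 * n), b ^ 4, (b * a) * (a⁻¹ * b⁻¹)⁻¹, (b⁻¹ * a) * (a⁻¹ * b)⁻¹}

/-- The group `V_{8n}`, given by its presentation. -/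
abbrev Grp (n : ℕ) : Type := PresentedGroup (relators n)

/-- The group algebra `F V_{8n}`. -/
abbrev Alg (n : ℕ) (F : Type*) [Field F] := MonoidAlgebra F (Grp n)

/-- The element `a ^ i` of the group algebra, for an integer `i`. -/
noncomputable def a {n : ℕ} {F : Type*} [Field F] (i : ℤ) : Alg n F :=
  MonoidAlgebra.of F (Grp n) ((PresentedGroup.of Gen.a : Grp n) ^ i)

/-- The element `b ^ j` of the group algebra, for an integer `j`. -/
noncomputable def b {n : ℕ} {F : Type*} [Field F] (j : ℤ) : Alg n F :=
  MonoidAlgebra.of F (Grp n) ((PresentedGroup.of Gen.b : Grp n) ^ j)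

/-- The `F`-module `Der_F(A)` of `F`-linear derivations of a not necessarily commutative
`F`-algebra `A`, that is, of the `F`-linear maps `d : A → A` satisfying
`d (x * y) = d x * y + x * d y`. (Mathlib's `Derivation` requires a commutative algebra.) -/
def Der (F A : Type*) [Field F] [Ring A] [Algebra F A] : Submodule F (A →ₗ[F] A) where
  carrier := {d | ∀ x y : A, d (x * y) = d x * y + x * d y}
  zero_mem' := by intro x y; simp
  add_mem' := by
    intro d e hd he x y
    simp only [LinearMap.add_apply, hd x y, he x y, add_mul, mul_add]
    abel
  smul_mem' := by
    intro c d hd x y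
    simp only [LinearMap.smul_apply, hd x y, smul_add, smul_mul_assoc, mul_smul_comm]

/-- The pair `(d(a), d(b))` of values of a derivation `d` on the two generators. -/
noncomputable def values {n : ℕ} {F : Type*} [Field F] (d : Der F (Alg n F)) :
    Alg n F × Alg n F :=
  (d.1 (a 1), d.1 (b 1))

/-- The set `{d_(u,v) ∣ (u, v) ∈ S}` of the derivations with `(d(a), d(b)) ∈ S`. -/
def derSet {n : ℕ} {F : Type*} [Field F] (S : Set (Alg n F × Alg n F)) :
    Set (Der F (Alg n F)) :=
  {d | values d ∈ S}

/-- For every `(u, v) ∈ S` there is exactly one `F`-derivation `d_(u,v)` with `d(a) = u` and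
`d(b) = v`, and the set of all these derivations is an `F`-basis of `Der_F(F V_{8n})`. -/
def IsDerBasis {n : ℕ} {F : Type*} [Field F] (S : Set (Alg n F × Alg n F)) : Prop :=
  (∀ s ∈ S, ∃! d : Der F (Alg n F), values d = s) ∧
  LinearIndependent F ((↑) : derSet S → Der F (Alg n F)) ∧
  Submodule.span F (derSet S) = ⊤

section Lists

variable (n : ℕ) (F : Type*) [Field F]

/-! In the index ranges below, division is division in `ℕ`: for `n ≥ 1`, `(n - 1) / 2` is
`⌊(n - 1) / 2⌋`, `(n + 1) / 2` is `⌊(n + 1) / 2⌋` and `n / 2` is `⌈(n - 1) / 2⌉`.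
All exponents are integers. -/

def B₁ : Set (Alg n F × Alg n F) :=
  {s | ∃ k ∈ Finset.Icc 1 ((n - 1) / 2), s ∈ ({
    ((a (-(2 * k)) - a (2 * k)) * b 1, 0),
    ((a (2 * k - 1) - a (-(2 * k + 1))) * b 1, a (2 * k) - a (-(2 * k))),
    ((a (-(2 * k)) - a (2 * k)) * b 3, 0),
    ((a (2 * k - 1) - a (-(2 * k + 1))) * b 3, (a (2 * k) - a (-(2 * k))) * b 2),
    (0, (a (2 * k) - a (-(2 * k))) * b 1),
    (0, (a (2 * k) - a (-(2 * k))) * b 3)} : Set (Alg n F × Alg n F))}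

def B₂ : Set (Alg n F × Alg n F) :=
  {s | ∃ k ∈ Finset.Icc 1 ((n + 1) / 2), s ∈ ({
    ((a (2 * k - 2) - a (-(2 * k)) * b 2) * b 1, a (2 * k - 1) - a (-(2 * k - 1)) * b 2),
    (0, (a (2 * k - 1) - a (-(2 * k - 1)) * b 2) * b 1)} : Set (Alg n F × Alg n F))}

def B₃ : Set (Alg n F × Alg n F) :=
  {s | ∃ k ∈ Finset.Icc 1 (n / 2), s ∈ ({
    ((a (-(2 * k)) - a (2 * k - 2) * b 2) * b 1, a (-(2 * k - 1)) - a (2 * k - 1) * b 2),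
    (0, (a (-(2 * k - 1)) - a (2 * k - 1) * b 2) * b 1)} : Set (Alg n F × Alg n F))}

def B₄ : Set (Alg n F × Alg n F) :=
  {s | ∃ k ∈ Finset.Icc 1 n,
    s = ((a (-(2 * k - 1)) - a (2 * k - 1) * b 2) * b 1, 0)}

def B₁' : Set (Alg n F × Alg n F) :=
  {s | ∃ k ∈ Finset.Icc 1 ((n - 1) / 2), s ∈ ({
    ((a (2 * k - 1) - a (-(2 * k + 1))) * b 1, a (2 * k) - a (-(2 * k))),
    (a (2 * k + 1) - a (-(2 * k - 1)), (a (2 * k) - a (-(2 * k))) * b 1),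
    ((a (2 * k - 1) - a (-(2 * k + 1))) * b 3, (a (2 * k) - a (-(2 * k))) * b 2),
    ((a (2 * k + 1) - a (-(2 * k - 1))) * b 2, (a (2 * k) - a (-(2 * k))) * b 3),
    ((a (-(2 * k)) - a (2 * k)) * b 3, 0),
    ((a (-(2 * k)) - a (2 * k)) * b 1, 0),
    ((a (-(2 * k - 1)) - a (2 * k + 1)) * b 2, 0),
    (a (-(2 * k - 1)) - a (2 * k + 1), 0)} : Set (Alg n F × Alg n F))}

def B₂' : Set (Alg n F × Alg n F) :=
  {s | ∃ k ∈ Finset.Icc 1 ((n + 1) / 2), s ∈ ({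
    ((a (2 * k - 2) - a (-(2 * k)) * b 2) * b 1, a (2 * k - 1) - a (-(2 * k - 1)) * b 2),
    (a (2 * k) - a (-(2 * k - 2)) * b 2, (a (2 * k - 1) - a (-(2 * k - 1)) * b 2) * b 1)} :
      Set (Alg n F × Alg n F))}

def B₃' : Set (Alg n F × Alg n F) :=
  {s | ∃ k ∈ Finset.Icc 1 (n / 2), s ∈ ({
    ((a (-(2 * k)) - a (2 * k - 2) * b 2) * b 1, a (-(2 * k - 1)) - a (2 * k - 1) * b 2),
    (a (-(2 * k - 2)) - a (2 * k) * b 2, (a (-(2 * k - 1)) - a (2 * k - 1) * b 2) * b 1)} :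
      Set (Alg n F × Alg n F))}

def B₄' : Set (Alg n F × Alg n F) :=
  {s | ∃ k ∈ Finset.Icc 1 n, s ∈ ({
    ((a (-(2 * k - 1)) - a (2 * k - 1) * b 2) * b 1, 0),
    (a (-(2 * k - 2)) - a (2 * k) * b 2, 0)} : Set (Alg n F × Alg n F))}

end Lists

end V8n

/-! Put z = b². The relations make z central of order 2 and give b a b⁻¹ = a⁻¹z, so N = ⟨a⟩ × ⟨z⟩ ≅
ℤ/2n × ℤ/2 has index 2. With R = F[N] and σ the conjugation by b on R, the group algebra is R ⊕ Rb,
where bx = σ(x)b and b² = z.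

A derivation d amounts to a homomorphism x ↦ x + ε d(x) into the dual numbers. It is therefore
determined by u = d(a) and v = d(b), and a pair (u, v) occurs iff a + εu and b + εv still satisfy
the relations. Write u = u₀ + u₁b, v = v₀ + v₁b, and R⁻ = {x ∈ R : σ(x) = -x}. In characteristic ≠ 2
the relation b⁴ = 1 forces d(z) = 0, that is, v₀, v₁ ∈ R⁻. Given this, baba = 1 says a⁻¹u₀ ∈ R⁻ and
u₁ - a⁻¹v₀ ∈ R⁻, and a^(2n) = 1 says n u₀ = 0. The last relation also constrains u₁, but this is
automatic because a - σ(a) divides every element of R⁻. This is `exists_der_iff`; it identifies the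
derivations with (R⁻)³ when n ≠ 0 in F and with (R⁻)⁴ when n = 0 (`range_innerVal`,
`range_outerVal`).

The elements g - σ(g), with g running over representatives of the σ-orbits of length two in N, form
a basis of R⁻. Since a^m z^j is fixed iff m is even and m ≡ 0 or n mod 2n, there are 2n - 1 such
orbits for odd n and 2n - 2 for even n. The explicit lists are the images of two such bases,
`oddBasis` and `smallBasis`. -/

namespace V8n

/-! ### The group `V_{8n}` -/

section Group

variable {n : ℕ}

/-- The generator `a` of `V_{8n}`. -/
def genA (n : ℕ) : Grp n := PresentedGroup.of Gen.a

/-- The generator `b` of `V_{8n}`. -/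
def genB (n : ℕ) : Grp n := PresentedGroup.of Gen.b

theorem genA_pow : genA n ^ (2 * n) = 1 :=
  PresentedGroup.one_of_mem (rels := relators n) (x := FreeGroup.of Gen.a ^ (2 * n))
    (by simp [relators])

theorem genB_pow : genB n ^ 4 = 1 :=
  PresentedGroup.one_of_mem (rels := relators n) (x := FreeGroup.of Gen.b ^ 4)
    (by simp [relators])

theorem genB_mul_genA : genB n * genA n = (genA n)⁻¹ * (genB n)⁻¹ :=
  mul_inv_eq_one.mp <| PresentedGroup.one_of_mem (rels := relators n)
    (x := (FreeGroup.of Gen.b * FreeGroup.of Gen.a) *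
      ((FreeGroup.of Gen.a)⁻¹ * (FreeGroup.of Gen.b)⁻¹)⁻¹) (by simp [relators])

theorem genB_inv_mul_genA : (genB n)⁻¹ * genA n = (genA n)⁻¹ * genB n :=
  mul_inv_eq_one.mp <| PresentedGroup.one_of_mem (rels := relators n)
    (x := ((FreeGroup.of Gen.b)⁻¹ * FreeGroup.of Gen.a) *
      ((FreeGroup.of Gen.a)⁻¹ * FreeGroup.of Gen.b)⁻¹) (by simp [relators])

/-- The universal property of `V_{8n}`. -/
theorem exists_hom {H : Type*} [Group H] (x y : H) (h₁ : x ^ (2 * n) = 1) (h₂ : y ^ 4 = 1)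
    (h₃ : y * x = x⁻¹ * y⁻¹) (h₄ : y⁻¹ * x = x⁻¹ * y) :
    ∃ f : Grp n →* H, f (genA n) = x ∧ f (genB n) = y := by
  let f : Gen → H := fun g => match g with
    | Gen.a => x
    | Gen.b => y
  have h : ∀ r ∈ relators n, FreeGroup.lift f r = 1 := by
    intro r hr
    simp only [relators, Set.mem_insert_iff, Set.mem_singleton_iff] at hr
    rcases hr with rfl | rfl | rfl | rfl
    · simpa [f] using h₁
    · simpa [f] using h₂
    · simp only [map_mul, map_inv, FreeGroup.lift_apply_of, f]
      rw [h₃, mul_inv_cancel]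
    · simp only [map_mul, map_inv, FreeGroup.lift_apply_of, f]
      rw [h₄, mul_inv_cancel]
  exact ⟨PresentedGroup.toGroup h, PresentedGroup.toGroup.of h, PresentedGroup.toGroup.of h⟩

theorem genB_mul_genA_mul_genB : genB n * genA n * genB n = (genA n)⁻¹ := by
  rw [genB_mul_genA]; group

/-- The two mixed relations read a = b a⁻¹ b and a⁻¹ = b a b. Substituting one into the other gives
a = b² a b², and b⁴ = 1 moves one factor across. -/
theorem genA_mul_genB_sq : genA n * genB n ^ 2 = genB n ^ 2 * genA n := by
  have h := genB_inv_mul_genA (n := n)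
  have h' := genB_mul_genA (n := n)
  have e : genA n = genB n * ((genA n)⁻¹ * genB n) := by rw [← h]; group
  have e' : (genA n)⁻¹ = genB n * genA n * genB n := by rw [h', inv_mul_cancel_right]
  have h4 : genB n ^ 2 * genB n ^ 2 = 1 := by rw [← pow_add]; exact genB_pow
  calc genA n * genB n ^ 2 = genB n * ((genA n)⁻¹ * genB n) * genB n ^ 2 := by rw [← e]
    _ = genB n * (genB n * genA n * genB n * genB n) * genB n ^ 2 := by rw [e']
    _ = genB n ^ 2 * genA n * (genB n ^ 2 * genB n ^ 2) := by simp only [pow_two, mul_assoc]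
    _ = _ := by rw [h4, mul_one]

/-- `⟨a⟩ × ⟨b ^ 2⟩` as an abstract group. -/
abbrev Base (n : ℕ) : Type := Multiplicative (ZMod (2 * n) × ZMod 2)

/-- The element `a ^ m (b ^ 2) ^ j` of the abelian subgroup. -/
def elt (n : ℕ) (m j : ℤ) : Base n := Multiplicative.ofAdd ((m : ZMod (2 * n)), (j : ZMod 2))

theorem elt_mul (m j m' j' : ℤ) : elt n m j * elt n m' j' = elt n (m + m') (j + j') := by
  simp [elt, ← ofAdd_add]

theorem elt_zero : elt n 0 0 = 1 := by simp [elt]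

theorem elt_pow (m j : ℤ) (k : ℕ) : elt n m j ^ k = elt n (k * m) (k * j) := by
  simp [elt, ← ofAdd_nsmul]

theorem elt_surj (x : Base n) : ∃ m j : ℤ, elt n m j = x := by
  obtain ⟨m, hm⟩ := ZMod.intCast_surjective x.toAdd.1
  obtain ⟨j, hj⟩ := ZMod.intCast_surjective x.toAdd.2
  exact ⟨m, j, by simp [elt, hm, hj]⟩

theorem elt_eq_iff (m j m' j' : ℤ) :
    elt n m j = elt n m' j' ↔ ((2 * n : ℕ) : ℤ) ∣ m' - m ∧ (2 : ℤ) ∣ j' - j := by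
  rw [elt, elt, Multiplicative.ofAdd.injective.eq_iff, Prod.mk.injEq,
    ZMod.intCast_eq_intCast_iff_dvd_sub, ZMod.intCast_eq_intCast_iff_dvd_sub]
  simp

/-- The automorphism of the abelian subgroup induced by conjugation with `b`. -/
def conj (n : ℕ) : Base n →* Base n :=
  AddMonoidHom.toMultiplicative
    { toFun := fun x => (-x.1, ZMod.castHom (dvd_mul_right 2 n) (ZMod 2) x.1 + x.2)
      map_zero' := by simp
      map_add' := by
        intro x y
        ext
        · simp [add_comm]
        · simp only [Prod.fst_add, Prod.snd_add, map_add]; ring }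

theorem conj_elt (m j : ℤ) : conj n (elt n m j) = elt n (-m) (m + j) := by
  simp [conj, elt]

theorem conj_conj (x : Base n) : conj n (conj n x) = x := by
  obtain ⟨m, j, rfl⟩ := elt_surj x
  rw [conj_elt, conj_elt, elt_eq_iff]
  constructor <;> ring_nf <;> simp

/-- The inclusion of the abelian subgroup into `V_{8n}`. -/
def incl (n : ℕ) : Base n →* Grp n :=
  AddMonoidHom.toMultiplicativeLeft <| AddMonoidHom.noncommCoprod
    (ZMod.lift (2 * n) ⟨zmultiplesHom (Additive (Grp n)) (Additive.ofMul (genA n)), by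
      simp [← ofMul_zpow]
      exact_mod_cast genA_pow⟩)
    (ZMod.lift 2 ⟨zmultiplesHom (Additive (Grp n)) (Additive.ofMul (genB n ^ 2)), by
      simp
      exact genB_pow⟩)
    (by
      intro x y
      obtain ⟨m, rfl⟩ := ZMod.intCast_surjective x
      obtain ⟨j, rfl⟩ := ZMod.intCast_surjective y
      have h : Commute (genA n) (genB n ^ 2) := genA_mul_genB_sq
      simpa [AddCommute, AddSemiconjBy] using congrArg Additive.ofMul (h.zpow_zpow m j).eq)

theorem incl_elt (m j : ℤ) : incl n (elt n m j) = genA n ^ m * (genB n ^ 2) ^ j := by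
  simp [incl, elt]

theorem genB_mul_incl (x : Base n) : genB n * incl n x = incl n (conj n x) * genB n := by
  obtain ⟨m, j, rfl⟩ := elt_surj x
  have hz : Commute (genA n) (genB n ^ 2) := genA_mul_genB_sq
  have ha : MulAut.conj (genB n) (genA n) = (genA n)⁻¹ * genB n ^ 2 := by
    have h : (genB n)⁻¹ * (genB n)⁻¹ = genB n ^ 2 := by
      rw [← mul_inv_rev, inv_eq_iff_mul_eq_one, ← pow_two, ← pow_add]
      exact genB_pow
    rw [MulAut.conj_apply, genB_mul_genA, mul_assoc, h]
  have hb : MulAut.conj (genB n) (genB n) = genB n := by simp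
  rw [conj_elt, incl_elt, incl_elt, ← mul_inv_eq_iff_eq_mul, ← MulAut.conj_apply, map_mul,
    map_zpow, map_zpow, map_pow, ha, hb, hz.inv_left.mul_zpow, zpow_add, inv_zpow', mul_assoc]

theorem genB_sq : genB n * genB n = incl n (elt n 0 1) := by
  simp [incl_elt, pow_two]

/-- Two dihedral quotients separate the elements. With a ↦ r, b ↦ s in the group of order 4n, the
power of a is seen modulo 2n, but b² dies. With a ↦ s, b ↦ r in the group of order 8, b² goes to r²
≠ 1. -/
theorem incl_injective : Function.Injective (incl n) := by
  rw [injective_iff_map_eq_one]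
  intro x hx
  obtain ⟨m, j, rfl⟩ := elt_surj x
  obtain ⟨f, hfa, hfb⟩ := exists_hom (n := n) (DihedralGroup.r 1 : DihedralGroup (2 * n))
    (DihedralGroup.sr 0) (by simp)
    (by simp [pow_succ]) (by simp) (by simp)
  have hm : ((m : ℤ) : ZMod (2 * n)) = 0 := by
    have := congrArg f hx
    rw [incl_elt] at this
    simpa [hfa, hfb, pow_two, DihedralGroup.one_def, -DihedralGroup.r_zero] using this
  obtain ⟨g, hga, hgb⟩ := exists_hom (n := n) (DihedralGroup.sr 0 : DihedralGroup 4)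
    (DihedralGroup.r 1) (by simp [pow_mul, pow_two])
    (by decide) (by decide) (by decide)
  have hm' : elt n m j = elt n 0 j := by simp [elt, hm]
  rw [hm'] at hx ⊢
  have hj : (2 : ℤ) ∣ j := by
    have := congrArg g hx
    rw [incl_elt] at this
    simp [hgb, DihedralGroup.one_def, -DihedralGroup.r_zero] at this
    have h4 : ((2 * j : ℤ) : ZMod 4) = 0 := by push_cast; exact this
    rw [ZMod.intCast_zmod_eq_zero_iff_dvd] at h4
    omega
  rw [← elt_zero, elt_eq_iff]
  exact ⟨by simp, by simpa using hj⟩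

/-- In the dihedral quotient a ↦ r, b ↦ s, the subgroup maps to rotations and its coset by b to
reflections. -/
theorem incl_ne_incl_mul_genB (x y : Base n) : incl n x ≠ incl n y * genB n := by
  intro h
  obtain ⟨m, j, rfl⟩ := elt_surj x
  obtain ⟨m', j', rfl⟩ := elt_surj y
  obtain ⟨f, hfa, hfb⟩ := exists_hom (n := n) (DihedralGroup.r 1 : DihedralGroup (2 * n))
    (DihedralGroup.sr 0) (by simp)
    (by simp [pow_succ]) (by simp) (by simp)
  have := congrArg f h
  rw [incl_elt, incl_elt] at this
  simp [hfa, hfb, pow_two] at this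

/-- The union of the subgroup and its coset by b is itself a subgroup containing both generators. -/
theorem exists_incl (g : Grp n) : (∃ x, g = incl n x) ∨ ∃ x, g = incl n x * genB n := by
  let S : Subgroup (Grp n) :=
    { carrier := {g | (∃ x, g = incl n x) ∨ ∃ x, g = incl n x * genB n}
      one_mem' := Or.inl ⟨1, by simp⟩
      mul_mem' := by
        rintro _ _ (⟨x, rfl⟩ | ⟨x, rfl⟩) (⟨y, rfl⟩ | ⟨y, rfl⟩)
        · exact Or.inl ⟨x * y, by simp⟩
        · exact Or.inr ⟨x * y, by simp [mul_assoc]⟩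
        · exact Or.inr ⟨x * conj n y, by rw [mul_assoc, genB_mul_incl, map_mul, mul_assoc]⟩
        · refine Or.inl ⟨x * conj n y * elt n 0 1, ?_⟩
          rw [map_mul, map_mul, ← genB_sq, mul_assoc, ← mul_assoc (genB n), genB_mul_incl]
          simp only [mul_assoc]
      inv_mem' := by
        rintro _ (⟨x, rfl⟩ | ⟨x, rfl⟩)
        · exact Or.inl ⟨x⁻¹, by simp⟩
        · refine Or.inr ⟨conj n x⁻¹ * (elt n 0 1)⁻¹, ?_⟩
          rw [mul_inv_rev, ← map_inv, mul_comm (conj n x⁻¹), map_mul, mul_assoc, ← genB_mul_incl,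
            map_inv, map_inv, ← genB_sq]
          group }
  have hS : S = ⊤ := by
    rw [eq_top_iff, ← PresentedGroup.closure_range_of (relators n), Subgroup.closure_le]
    rintro _ ⟨g, rfl⟩
    cases g with
    | a => exact Or.inl ⟨elt n 1 0, by simp [incl_elt, genA]⟩
    | b => exact Or.inr ⟨1, by simp [genB]⟩
  have : g ∈ S := hS ▸ Subgroup.mem_top g
  exact this

end Group

/-! ### The group algebra as a rank two module over a commutative subalgebra -/

section Algebra

variable {n : ℕ} {F : Type*} [Field F]

/-- The group algebra of the abelian subgroup `⟨a⟩ × ⟨b ^ 2⟩`. -/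
abbrev BaseAlg (n : ℕ) (F : Type*) [Field F] : Type _ := MonoidAlgebra F (Base n)

/-- The element `a ^ m (b ^ 2) ^ j` of the commutative subalgebra. -/
noncomputable def mono (m j : ℤ) : BaseAlg n F := MonoidAlgebra.of F (Base n) (elt n m j)

/-- Conjugation with `b` on the commutative subalgebra. -/
noncomputable def twist : BaseAlg n F →ₐ[F] BaseAlg n F :=
  MonoidAlgebra.mapDomainAlgHom F F (conj n)

/-- The inclusion of the commutative subalgebra. -/
noncomputable def emb : BaseAlg n F →ₐ[F] Alg n F :=
  MonoidAlgebra.mapDomainAlgHom F F (incl n)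

theorem mono_mul (m j m' j' : ℤ) :
    (mono m j * mono m' j' : BaseAlg n F) = mono (m + m') (j + j') := by
  rw [mono, mono, ← map_mul, elt_mul, mono]

theorem mono_pow (m j : ℤ) (k : ℕ) : (mono m j : BaseAlg n F) ^ k = mono (k * m) (k * j) := by
  rw [mono, ← map_pow, elt_pow, mono]

theorem mono_zero : (mono 0 0 : BaseAlg n F) = 1 := by rw [mono, elt_zero, map_one]

theorem mono_eq_mono {m j m' j' : ℤ} (h : ((2 * n : ℕ) : ℤ) ∣ m' - m) (h' : (2 : ℤ) ∣ j' - j) :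
    (mono m j : BaseAlg n F) = mono m' j' := by
  rw [mono, (elt_eq_iff m j m' j').mpr ⟨h, h'⟩, mono]

theorem mono_congr_right (m : ℤ) {j j' : ℤ} (h' : (2 : ℤ) ∣ j' - j) :
    (mono m j : BaseAlg n F) = mono m j' := mono_eq_mono (by simp) h'

theorem twist_mono (m j : ℤ) : twist (mono m j : BaseAlg n F) = mono (-m) (m + j) := by
  simp [twist, mono, conj_elt]

theorem b_two_eq : (b 2 : Alg n F) = emb (mono 0 1) := by
  simp [b, emb, mono, incl_elt, genB]

theorem a_eq (m : ℤ) : (a m : Alg n F) = emb (mono m 0) := by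
  simp [a, emb, mono, incl_elt, genA]

theorem b_one_mul_b_one : (b 1 * b 1 : Alg n F) = emb (mono 0 1) := by
  rw [← b_two_eq, b, b, ← map_mul, ← zpow_add]; rfl

theorem b_three_eq : (b 3 : Alg n F) = emb (mono 0 1) * b 1 := by
  rw [← b_two_eq, b, b, b, ← map_mul, ← zpow_add]; rfl

theorem b_mul_emb (x : BaseAlg n F) : b 1 * emb x = emb (twist x) * b 1 := by
  induction x using MonoidAlgebra.induction_linear with
  | zero => simp
  | add x y hx hy => simp only [map_add, mul_add, add_mul, hx, hy]
  | single g r =>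
    have := genB_mul_incl g
    simp only [genB] at this
    simp [emb, twist, b, this]

theorem exists_emb (r : Alg n F) : ∃ x y : BaseAlg n F, r = emb x + emb y * b 1 := by
  induction r using MonoidAlgebra.induction_linear with
  | zero => exact ⟨0, 0, by simp⟩
  | add r s hr hs =>
    obtain ⟨x, y, rfl⟩ := hr
    obtain ⟨x', y', rfl⟩ := hs
    exact ⟨x + x', y + y', by simp only [map_add, add_mul]; abel⟩
  | single g c =>
    obtain ⟨x, rfl⟩ | ⟨x, rfl⟩ := exists_incl g
    · exact ⟨MonoidAlgebra.single x c, 0, by simp [emb]⟩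
    · exact ⟨0, MonoidAlgebra.single x c, by simp [emb, b, genB]⟩

theorem emb_add_emb_mul_eq_zero {x y : BaseAlg n F} (h : emb x + emb y * b 1 = 0) :
    x = 0 ∧ y = 0 := by
  have h₁ (z : BaseAlg n F) (g : Base n) : (emb z).coeff (incl n g) = z.coeff g :=
    Finsupp.mapDomain_apply incl_injective _ _
  have h₂ (z : BaseAlg n F) (g : Base n) : (emb z).coeff (incl n g * genB n) = 0 := by
    refine Finsupp.mapDomain_of_notMem_range _ _ ?_
    rintro ⟨g', hg⟩
    exact incl_ne_incl_mul_genB _ _ hg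
  have hb : (b 1 : Alg n F) = MonoidAlgebra.single (genB n) 1 := by simp [b, genB]
  -- A coefficient of `emb y * b 1` at g is that of `emb y` at g b⁻¹; writing b⁻¹ = b² b shows that
  -- this point lies in the other coset when g is in the subgroup.
  have hb' : ((genB n)⁻¹ : Grp n) = incl n (elt n 0 1) * genB n := by
    rw [← genB_sq, ← pow_two, ← pow_succ, inv_eq_iff_mul_eq_one, ← pow_succ']
    exact genB_pow
  constructor <;> ext g
  · have := congrArg (fun z => z.coeff (incl n g)) h
    simpa [h₁, hb, hb', ← mul_assoc, ← map_mul, h₂] using this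
  · have := congrArg (fun z => z.coeff (incl n g * genB n)) h
    simpa [h₁, hb, h₂] using this

theorem emb_add_emb_mul_eq_iff {x y x' y' : BaseAlg n F} :
    emb x + emb y * b 1 = emb x' + emb y' * b 1 ↔ x = x' ∧ y = y' := by
  refine ⟨fun h => ?_, by rintro ⟨rfl, rfl⟩; rfl⟩
  have := emb_add_emb_mul_eq_zero (x := x - x') (y := y - y') (by
    rw [map_sub, map_sub, sub_mul, ← sub_eq_zero.mpr h]; abel)
  exact ⟨sub_eq_zero.mp this.1, sub_eq_zero.mp this.2⟩

/-- The elements of the commutative subalgebra which conjugation with `b` negates. -/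
noncomputable def antiInv (n : ℕ) (F : Type*) [Field F] : Submodule F (BaseAlg n F) :=
  LinearMap.ker (twist.toLinearMap + LinearMap.id)

theorem mem_antiInv {x : BaseAlg n F} : x ∈ antiInv n F ↔ twist x = -x := by
  simp [antiInv, eq_neg_iff_add_eq_zero]

end Algebra

/-! ### Bases of the space of anti-invariant elements -/

section AntiInvariant

variable {n : ℕ} {F : Type*} [Field F]

/-- The anti-invariant element `g - b g b⁻¹`. -/
noncomputable def skew (F : Type*) [Field F] (g : Base n) : antiInv n F :=
  ⟨MonoidAlgebra.of F _ g - MonoidAlgebra.of F _ (conj n g), by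
    rw [mem_antiInv, map_sub]
    simp [twist, conj_conj]⟩

theorem coe_skew (g : Base n) :
    (skew F g : BaseAlg n F) = MonoidAlgebra.of F _ g - MonoidAlgebra.of F _ (conj n g) := rfl

theorem coe_skew_elt (m j : ℤ) :
    (skew F (elt n m j) : BaseAlg n F) = mono m j - mono (-m) (m + j) := by
  rw [coe_skew, conj_elt]; rfl

theorem skew_conj (g : Base n) : skew F (conj n g) = -skew F g := by
  ext1
  simp [coe_skew, conj_conj]

theorem sub_twist_mem_of_skew_mem (p : Submodule F (BaseAlg n F))
    (h : ∀ g : Base n, (skew F g : BaseAlg n F) ∈ p) (x : BaseAlg n F) : x - twist x ∈ p := by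
  induction x using MonoidAlgebra.induction_linear with
  | zero => simp
  | add x y hx hy =>
    rw [map_add, add_sub_add_comm]
    exact p.add_mem hx hy
  | single g r =>
    convert p.smul_mem r (h g) using 1
    simp [coe_skew, twist, smul_sub]

/-- An anti-invariant x equals ½(x - σ(x)), a combination of the elements g - σ(g). This serves both
for spanning and for divisibility by a - σ(a). -/
theorem antiInv_le_of_skew_mem (h2 : (2 : F) ≠ 0) (p : Submodule F (BaseAlg n F))
    (h : ∀ g : Base n, (skew F g : BaseAlg n F) ∈ p) : antiInv n F ≤ p := by
  intro x hx
  have hx' : x = (2 : F)⁻¹ • (x - twist x) := by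
    rw [mem_antiInv.mp hx, sub_neg_eq_add, ← two_smul F x, smul_smul, inv_mul_cancel₀ h2, one_smul]
  rw [hx']
  exact p.smul_mem _ (sub_twist_mem_of_skew_mem p h x)

/-- Fixed g contribute 0 and the two members of an orbit contribute opposite elements, so one
representative per orbit of length two suffices. -/
theorem span_range_skew (h2 : (2 : F) ≠ 0) {I : Type*} (r : I → Base n)
    (hr : ∀ g, conj n g = g ∨ ∃ i, r i = g ∨ r i = conj n g) :
    ⊤ ≤ Submodule.span F (Set.range fun i => skew F (r i)) := by
  have key : antiInv n F ≤
      (Submodule.span F (Set.range fun i => skew F (r i))).map (antiInv n F).subtype := by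
    refine antiInv_le_of_skew_mem h2 _ fun g => ⟨skew F g, ?_, rfl⟩
    obtain hg | ⟨i, hi | hi⟩ := hr g
    · have : skew F g = 0 := by ext1; simp [coe_skew, hg]
      rw [this]
      exact Submodule.zero_mem _
    · exact hi ▸ Submodule.subset_span ⟨i, rfl⟩
    · have : skew F g = -skew F (r i) := by rw [hi, skew_conj, neg_neg]
      rw [this]
      exact Submodule.neg_mem _ (Submodule.subset_span ⟨i, rfl⟩)
  intro x _
  obtain ⟨y, hy, hyx⟩ := key x.2
  rwa [Subtype.ext hyx] at hy

/-- Under these hypotheses the group element r j occurs in the j-th vector only, with coefficient 1.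
-/
theorem linearIndependent_skew {I : Type*} {r : I → Base n} (hr : Function.Injective r)
    (hc : ∀ i j, conj n (r i) ≠ r j) : LinearIndependent F fun i => skew F (r i) := by
  classical
  rw [linearIndependent_iff']
  intro s c hs j hj
  have h := congrArg (fun x : antiInv n F => (x : BaseAlg n F).coeff (r j)) hs
  simpa [coe_skew, MonoidAlgebra.coeff_sum, Finsupp.single_apply, hr.eq_iff, hc, hj] using h

/-- Orbit representatives for conjugation with `b`, all odd powers of `a` being taken without
the factor `b ^ 2`. -/
def oddRep (n : ℕ) :
    Finset.Icc 1 ((n - 1) / 2) ⊕ Finset.Icc 1 ((n - 1) / 2) ⊕ Finset.Icc 1 n → Base n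
  | .inl k => elt n (-(2 * k.1)) 0
  | .inr (.inl k) => elt n (-(2 * k.1)) 1
  | .inr (.inr k) => elt n (-(2 * k.1 - 1)) 0

/-- Orbit representatives for conjugation with `b`, the exponents of `a` being taken as small
as possible. -/
def smallRep (n : ℕ) :
    Finset.Icc 1 ((n - 1) / 2) ⊕ Finset.Icc 1 ((n - 1) / 2) ⊕ Finset.Icc 1 ((n + 1) / 2) ⊕
      Finset.Icc 1 (n / 2) → Base n
  | .inl k => elt n (2 * k.1) 0
  | .inr (.inl k) => elt n (2 * k.1) 1
  | .inr (.inr (.inl k)) => elt n (2 * k.1 - 1) 0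
  | .inr (.inr (.inr k)) => elt n (-(2 * k.1 - 1)) 0

theorem exists_elt_eq (hn : 1 ≤ n) (g : Base n) : ∃ m j : ℕ, m < 2 * n ∧ j < 2 ∧ elt n m j = g := by
  obtain ⟨m, j, rfl⟩ := elt_surj g
  have hn' : (0 : ℤ) < (2 * n : ℕ) := by omega
  obtain ⟨m', hm'⟩ := Int.eq_ofNat_of_zero_le (Int.emod_nonneg m hn'.ne')
  obtain ⟨j', hj'⟩ := Int.eq_ofNat_of_zero_le (Int.emod_nonneg j two_ne_zero)
  refine ⟨m', j', ?_, ?_, ?_⟩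
  · have := Int.emod_lt_of_pos m hn'
    omega
  · omega
  · rw [elt_eq_iff, ← hm', ← hj']
    exact ⟨Int.dvd_self_sub_emod, Int.dvd_self_sub_emod⟩

theorem elt_eq_of_eq {m j m' j' : ℤ} (c : ℤ) (h : m' = m + 2 * (n * c)) (h' : (2 : ℤ) ∣ j' - j) :
    elt n m j = elt n m' j' := by
  refine (elt_eq_iff _ _ _ _).mpr ⟨⟨c, ?_⟩, h'⟩
  rw [h]; push_cast; ring

/-- For even m, conjugation sends a^m to a^(-m) and keeps the b²-part, so only m ≡ 0, n are fixed.
For odd m it also toggles the factor b², so every orbit has exactly one member without that factor.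
-/
theorem oddRep_cover (hn : 1 ≤ n) (g : Base n) :
    conj n g = g ∨ ∃ i, oddRep n i = g ∨ oddRep n i = conj n g := by
  obtain ⟨m, j, hm, hj, rfl⟩ := exists_elt_eq hn g
  rw [conj_elt]
  obtain ⟨l, rfl | rfl⟩ := m.even_or_odd'
  · obtain rfl | hl := l.eq_zero_or_pos
    · left; simp
    obtain hl' | hl' | hl' := lt_trichotomy (2 * l) n
    · right
      interval_cases j
      · exact ⟨.inl ⟨l, by simp; omega⟩, .inr (elt_eq_of_eq 0 (by simp) (by simp))⟩
      · exact ⟨.inr (.inl ⟨l, by simp; omega⟩), .inr (elt_eq_of_eq 0 (by simp) (by simp))⟩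
    · left
      exact elt_eq_of_eq 1 (by omega) (by omega)
    · right
      interval_cases j
      · exact ⟨.inl ⟨n - l, by simp; omega⟩, .inl (elt_eq_of_eq 1 (by simp only; omega) (by simp))⟩
      · exact ⟨.inr (.inl ⟨n - l, by simp; omega⟩),
          .inl (elt_eq_of_eq 1 (by simp only; omega) (by simp))⟩
  · right
    interval_cases j
    · exact ⟨.inr (.inr ⟨n - l, by simp; omega⟩),
        .inl (elt_eq_of_eq 1 (by simp only; omega) (by simp))⟩
    · exact ⟨.inr (.inr ⟨l + 1, by simp; omega⟩),
        .inr (elt_eq_of_eq 0 (by simp only; omega) (by omega))⟩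

/-- For odd exponents the member without b² is written with exponent of absolute value at most n. As
n ≡ -n mod 2n, the exponent n is listed with the positive sign only, which explains the two
different ranges. -/
theorem smallRep_cover (hn : 1 ≤ n) (g : Base n) :
    conj n g = g ∨ ∃ i, smallRep n i = g ∨ smallRep n i = conj n g := by
  obtain ⟨m, j, hm, hj, rfl⟩ := exists_elt_eq hn g
  rw [conj_elt]
  obtain ⟨l, rfl | rfl⟩ := m.even_or_odd'
  · obtain rfl | hl := l.eq_zero_or_pos
    · left; simp
    obtain hl' | hl' | hl' := lt_trichotomy (2 * l) n
    · right
      interval_cases j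
      · exact ⟨.inl ⟨l, by simp; omega⟩, .inl (elt_eq_of_eq 0 (by simp) (by simp))⟩
      · exact ⟨.inr (.inl ⟨l, by simp; omega⟩), .inl (elt_eq_of_eq 0 (by simp) (by simp))⟩
    · left
      exact elt_eq_of_eq 1 (by omega) (by omega)
    · right
      interval_cases j
      · exact ⟨.inl ⟨n - l, by simp; omega⟩,
          .inr (elt_eq_of_eq (-1) (by simp only; omega) (by simp))⟩
      · exact ⟨.inr (.inl ⟨n - l, by simp; omega⟩),
          .inr (elt_eq_of_eq (-1) (by simp only; omega) (by simp))⟩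
  · right
    interval_cases j
    · obtain h | h := le_or_gt (2 * l + 1) n
      · exact ⟨.inr (.inr (.inl ⟨l + 1, by simp; omega⟩)),
          .inl (elt_eq_of_eq 0 (by simp only; omega) (by simp))⟩
      · exact ⟨.inr (.inr (.inr ⟨n - l, by simp; omega⟩)),
          .inl (elt_eq_of_eq 1 (by simp only; omega) (by simp))⟩
    · obtain h | h := lt_or_ge (2 * l + 1) n
      · exact ⟨.inr (.inr (.inr ⟨l + 1, by simp; omega⟩)),
          .inr (elt_eq_of_eq 0 (by simp only; omega) (by omega))⟩
      · exact ⟨.inr (.inr (.inl ⟨n - l, by simp; omega⟩)),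
          .inr (elt_eq_of_eq (-1) (by simp only; omega) (by omega))⟩

theorem eq_of_dvd_of_lt {k l : ℤ} (h : ((2 * n : ℕ) : ℤ) ∣ k - l) (h₁ : k < l + 2 * n)
    (h₂ : l < k + 2 * n) : k = l := by
  refine sub_eq_zero.mp (Int.eq_zero_of_abs_lt_dvd h (abs_lt.mpr ⟨?_, ?_⟩)) <;> push_cast <;> omega

theorem oddRep_injective : Function.Injective (oddRep n) := by
  rintro (⟨k, hk⟩ | ⟨k, hk⟩ | ⟨k, hk⟩) (⟨l, hl⟩ | ⟨l, hl⟩ | ⟨l, hl⟩) h <;>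
    simp only [oddRep, elt_eq_iff] at h <;> obtain ⟨h, h'⟩ := h <;>
    have h₂ : (2 : ℤ) ∣ _ := Dvd.dvd.trans ⟨n, by push_cast; rfl⟩ h <;>
    rw [Finset.mem_Icc] at hk hl
  all_goals first
    | (exfalso; omega)
    | (have := eq_of_dvd_of_lt h (by omega) (by omega)
       obtain rfl : k = l := by omega
       rfl)

/-- For even exponents 2k + 2l lies strictly between 0 and 2n, as k, l ≤ (n - 1) / 2. For odd ones
the b²-exponents differ in parity, and in the mixed cases the a-exponents do. -/
theorem conj_oddRep_ne (i j) : conj n (oddRep n i) ≠ oddRep n j := by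
  intro h
  obtain ⟨k, hk⟩ | ⟨k, hk⟩ | ⟨k, hk⟩ := i <;> obtain ⟨l, hl⟩ | ⟨l, hl⟩ | ⟨l, hl⟩ := j <;>
    simp only [oddRep, conj_elt, elt_eq_iff] at h <;> obtain ⟨h, h'⟩ := h <;>
    have h₂ : (2 : ℤ) ∣ _ := Dvd.dvd.trans ⟨n, by push_cast; rfl⟩ h <;>
    rw [Finset.mem_Icc] at hk hl
  all_goals first
    | omega
    | (have := eq_of_dvd_of_lt h (by omega) (by omega)
       omega)

/-- The basis of the anti-invariant elements given by the representatives `oddRep`. -/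
noncomputable def oddBasis (hn : 1 ≤ n) (h2 : (2 : F) ≠ 0) :
    Module.Basis (Finset.Icc 1 ((n - 1) / 2) ⊕ Finset.Icc 1 ((n - 1) / 2) ⊕ Finset.Icc 1 n) F
      (antiInv n F) :=
  .mk (linearIndependent_skew oddRep_injective conj_oddRep_ne)
    (span_range_skew h2 _ (oddRep_cover hn))

theorem oddBasis_apply (hn : 1 ≤ n) (h2 : (2 : F) ≠ 0) (i) :
    oddBasis hn h2 i = skew F (oddRep n i) := by simp [oddBasis]

theorem finrank_antiInv (hn : 1 ≤ n) (h2 : (2 : F) ≠ 0) :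
    Module.finrank F (antiInv n F) = 2 * ((n - 1) / 2) + n := by
  rw [Module.finrank_eq_card_basis (oddBasis hn h2)]
  simp; omega

/-- The basis of the anti-invariant elements given by the representatives `smallRep`. -/
noncomputable def smallBasis (hn : 1 ≤ n) (h2 : (2 : F) ≠ 0) :
    Module.Basis (Finset.Icc 1 ((n - 1) / 2) ⊕ Finset.Icc 1 ((n - 1) / 2) ⊕
      Finset.Icc 1 ((n + 1) / 2) ⊕ Finset.Icc 1 (n / 2)) F (antiInv n F) :=
  -- Independence comes from counting: the spanning family has as many members as the dimension
  -- found from `oddBasis`.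
  basisOfTopLeSpanOfCardEqFinrank (fun i => skew F (smallRep n i))
    (span_range_skew h2 _ (smallRep_cover hn)) (by
      rw [finrank_antiInv hn h2]; simp; omega)

theorem smallBasis_apply (hn : 1 ≤ n) (h2 : (2 : F) ≠ 0) (i) :
    smallBasis hn h2 i = skew F (smallRep n i) := by simp [smallBasis]

end AntiInvariant

/-! ### Derivations and their values on the generators -/

section Derivations

variable {n : ℕ} {F : Type*} [Field F]

theorem der_mul (d : Der F (Alg n F)) (x y : Alg n F) :
    d.1 (x * y) = d.1 x * y + x * d.1 y := d.2 x y

theorem der_one (d : Der F (Alg n F)) : d.1 1 = 0 := by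
  have := der_mul d 1 1
  simpa using this

/-- `values` as a linear map. -/
noncomputable def valuesLin (n : ℕ) (F : Type*) [Field F] :
    Der F (Alg n F) →ₗ[F] Alg n F × Alg n F where
  toFun := values
  map_add' _ _ := rfl
  map_smul' _ _ := rfl

/-- The group elements killed by a derivation form a subgroup, which is everything once it contains
a and b. -/
theorem valuesLin_injective : Function.Injective (valuesLin n F) := by
  rw [injective_iff_map_eq_zero]
  intro d hd
  have hd' : values d = 0 := hd
  let S : Subgroup (Grp n) :=
    { carrier := {g | d.1 (MonoidAlgebra.of F _ g) = 0}
      one_mem' := by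
        simp only [Set.mem_ofPred_eq, map_one]
        exact der_one d
      mul_mem' := by
        intro g h hg hh
        simp only [Set.mem_ofPred_eq] at hg hh ⊢
        rw [map_mul, der_mul d, hg, hh]
        simp
      inv_mem' := by
        intro g hg
        simp only [Set.mem_ofPred_eq] at hg ⊢
        have h := der_mul d (MonoidAlgebra.of F _ g⁻¹) (MonoidAlgebra.of F _ g)
        rw [← map_mul, inv_mul_cancel, map_one, der_one d, hg, mul_zero,
          add_zero] at h
        have h' := congrArg (· * MonoidAlgebra.of F _ g⁻¹) h
        simp only [zero_mul, mul_assoc, ← map_mul, mul_inv_cancel, map_one,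
          mul_one] at h'
        exact h'.symm }
  have hS : S = ⊤ := by
    rw [eq_top_iff, ← PresentedGroup.closure_range_of (relators n), Subgroup.closure_le]
    rintro _ ⟨g, rfl⟩
    cases g with
    | a =>
      have : d.1 (a 1) = 0 := congrArg Prod.fst hd'
      rwa [a, zpow_one] at this
    | b =>
      have : d.1 (b 1) = 0 := congrArg Prod.snd hd'
      rwa [b, zpow_one] at this
  refine Subtype.ext (LinearMap.ext fun x => ?_)
  induction x using MonoidAlgebra.induction_linear with
  | zero => simp
  | add x y hx hy => rw [map_add, hx, hy, map_add]
  | single g r =>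
    have hg : g ∈ S := hS ▸ Subgroup.mem_top g
    have hg' : d.1 (MonoidAlgebra.of F _ g) = 0 := hg
    have : MonoidAlgebra.single g r = r • MonoidAlgebra.of F _ g := by simp
    rw [this, map_smul, hg', smul_zero]
    simp

theorem values_injective : Function.Injective (values : Der F (Alg n F) → _) :=
  valuesLin_injective

theorem b_two_comm (r : Alg n F) : b 2 * r = r * b 2 := by
  obtain ⟨x, y, rfl⟩ := exists_emb r
  have h : twist (mono 0 1 : BaseAlg n F) = mono 0 1 := by rw [twist_mono]; simp
  rw [b_two_eq, mul_add, add_mul, ← map_mul, ← map_mul, mul_assoc (emb y),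
    b_mul_emb, h, ← mul_assoc, ← mul_assoc, ← map_mul, ← map_mul, mul_comm x,
    mul_comm y]

/-- Recovers the last relation of the presentation from yxyx = 1 and the behaviour of y², so that
its derivative need not be checked separately. -/
theorem inv_mul_eq_inv_mul {H : Type*} [Group H] {x y : H} (h : y * x * y * x = 1)
    (hxy : x * (y * y) = y * y * x) (hy : y * y * (y * y) = 1) : y⁻¹ * x = x⁻¹ * y := by
  have h₁ : y⁻¹ = y * y * y := by rw [inv_eq_iff_mul_eq_one, ← hy]; simp only [mul_assoc]
  have h₂ : x * y * x = y⁻¹ := by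
    rw [eq_inv_iff_mul_eq_one, ← mul_right_inj y, ← mul_assoc, ← mul_assoc, ← mul_assoc, h]
    simp
  rw [eq_inv_mul_iff_mul_eq, h₁, mul_assoc (y * y), ← mul_assoc x, hxy, mul_assoc, ← mul_assoc x,
    h₂, mul_assoc, mul_inv_cancel, mul_one]

open TrivSqZeroExt in
/-- Values on the generators that are compatible with the relations extend to a derivation. -/
theorem exists_der {u v : Alg n F} (h₁ : b 1 * v + v * b 1 = 0)
    (h₂ : v * a 1 * b 1 * a 1 + b 1 * u * b 1 * a 1 + b 1 * a 1 * v * a 1 +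
      b 1 * a 1 * b 1 * u = 0)
    (h₃ : (inl (a 1) + inr u : DualNumber (Alg n F)) ^ (2 * n) = 1) (hn : 1 ≤ n) :
    ∃ d : Der F (Alg n F), values d = (u, v) := by
  -- The elements a + εu and b + εv are shown to satisfy the defining relations. The ε-part of the
  -- resulting homomorphism is the derivation, once its constant part is known to be the identity.
  set A : DualNumber (Alg n F) := inl (a 1) + inr u with hA
  set B : DualNumber (Alg n F) := inl (b 1) + inr v with hB
  set Z : DualNumber (Alg n F) := inl (b 2) with hZ
  have hBB : B * B = Z := by
    refine TrivSqZeroExt.ext ?_ ?_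
    · simp [hB, hZ, b, ← pow_two]
    · simpa [hB, hZ] using h₁
  have hZZ : Z * Z = 1 := by
    rw [hZ, ← inl_mul, b, ← map_mul, ← zpow_add]
    have : (PresentedGroup.of Gen.b : Grp n) ^ (2 + 2 : ℤ) = 1 := genB_pow
    rw [this, map_one, inl_one]
  have hZA : Z * A = A * Z := by
    refine TrivSqZeroExt.ext ?_ ?_ <;> simp [hZ, hA, b_two_comm]
  have hbaba : (b 1 * a 1 * b 1 * a 1 : Alg n F) = 1 := by
    have := genB_mul_genA_mul_genB (n := n)
    simp only [a, b, ← map_mul, zpow_one]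
    rw [show (PresentedGroup.of Gen.b * PresentedGroup.of Gen.a * PresentedGroup.of Gen.b : Grp n)
      = _ from this]
    rw [genA, inv_mul_cancel, map_one]
  have hBABA : B * A * B * A = 1 := by
    refine TrivSqZeroExt.ext ?_ ?_
    · simpa [hA, hB] using hbaba
    · simp [hA, hB]
      rw [← h₂]
      noncomm_ring
  have hB4 : B ^ 4 = 1 := by
    rw [show 4 = 2 * 2 from rfl, pow_mul, pow_two B, hBB, pow_two, hZZ]
  let Au : (DualNumber (Alg n F))ˣ := Units.ofPowEqOne A (2 * n) h₃ (by omega)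
  let Bu : (DualNumber (Alg n F))ˣ := Units.ofPowEqOne B 4 hB4 (by omega)
  have hBABA' : Bu * Au * Bu * Au = 1 := Units.ext hBABA
  obtain ⟨f, hfa, hfb⟩ := exists_hom (n := n) Au Bu (Units.ext h₃) (Units.ext hB4)
    (by rw [← mul_inv_rev, eq_inv_iff_mul_eq_one, ← mul_assoc]; exact hBABA')
    (inv_mul_eq_inv_mul hBABA' (Units.ext (by
      change A * (B * B) = B * B * A
      rw [hBB, hZA])) (Units.ext (by
      change B * B * (B * B) = 1
      rw [hBB, hZZ])))
  let φ : Alg n F →ₐ[F] DualNumber (Alg n F) :=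
    MonoidAlgebra.lift F _ _ ((Units.coeHom _).comp f)
  have hφa : φ (a 1) = A := by
    rw [← show ((f (genA n) : (DualNumber (Alg n F))ˣ) : DualNumber (Alg n F)) = A from
      congrArg Units.val hfa]
    simp [φ, a, genA]
  have hφb : φ (b 1) = B := by
    rw [← show ((f (genB n) : (DualNumber (Alg n F))ˣ) : DualNumber (Alg n F)) = B from
      congrArg Units.val hfb]
    simp [φ, b, genB]
  have hfst : ∀ x, (φ x).fst = x := by
    have h : (fstHom F (Alg n F) (Alg n F)).comp φ = AlgHom.id F _ := by
      let k : Grp n →* Alg n F := (MonoidHomClass.toMonoidHom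
        ((fstHom F (Alg n F) (Alg n F)).comp φ)).comp (MonoidAlgebra.of F (Grp n))
      -- Passing to units makes the target a group, where agreement on the generators of a presented
      -- group can be used.
      have h' : k.toHomUnits = (MonoidAlgebra.of F (Grp n)).toHomUnits := by
        refine PresentedGroup.ext fun g => Units.ext ?_
        cases g with
        | a => simpa [a, hA, k] using congrArg fst hφa
        | b => simpa [b, hB, k] using congrArg fst hφb
      refine MonoidAlgebra.algHom_ext (fun g => ?_) (Subsingleton.elim _ _)
      exact congrArg Units.val (DFunLike.congr_fun h' g)
    exact fun x => DFunLike.congr_fun h x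
  refine ⟨⟨(sndHom (Alg n F) (Alg n F)).restrictScalars F ∘ₗ φ.toLinearMap, ?_⟩, ?_⟩
  · intro x y
    simp [hfst]
    rw [add_comm]
  · ext1
    · simp [values, hφa, hA]
    · simp [values, hφb, hB]

end Derivations

/-! ### Which pairs of values occur -/

section Characterization

variable {n : ℕ} {F : Type*} [Field F]

/-- The element `x + y b` of the group algebra. -/
noncomputable def pair (x y : BaseAlg n F) : Alg n F := emb x + emb y * b 1

theorem exists_pair (r : Alg n F) : ∃ x y : BaseAlg n F, r = pair x y := exists_emb r

theorem pair_eq_pair {x y x' y' : BaseAlg n F} : pair x y = pair x' y' ↔ x = x' ∧ y = y' :=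
  emb_add_emb_mul_eq_iff

theorem pair_zero : (pair 0 0 : Alg n F) = 0 := by simp [pair]

theorem pair_one : (pair 1 0 : Alg n F) = 1 := by simp [pair]

theorem pair_eq_zero {x y : BaseAlg n F} : pair x y = 0 ↔ x = 0 ∧ y = 0 := by
  rw [← pair_zero, pair_eq_pair]

theorem pair_add (x y x' y' : BaseAlg n F) :
    pair x y + pair x' y' = pair (x + x') (y + y') := by
  simp only [pair, map_add, add_mul]; abel

theorem pair_sub (x y x' y' : BaseAlg n F) :
    pair x y - pair x' y' = pair (x - x') (y - y') := by
  simp only [pair, map_sub, sub_mul]; abel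

theorem smul_pair (c : F) (x y : BaseAlg n F) : c • pair x y = pair (c • x) (c • y) := by
  simp only [pair, map_smul, smul_add, smul_mul_assoc]

theorem pair_mul (x y x' y' : BaseAlg n F) :
    pair x y * pair x' y' =
      pair (x * x' + y * twist y' * mono 0 1) (x * y' + y * twist x') := by
  have h₁ : emb y * b 1 * emb x' = emb (y * twist x') * b 1 := by
    rw [mul_assoc, b_mul_emb, ← mul_assoc, map_mul]
  have h₂ : emb y * b 1 * (emb y' * b 1) = emb (y * twist y' * mono 0 1) := by
    rw [mul_assoc, ← mul_assoc (b 1), b_mul_emb, mul_assoc, b_one_mul_b_one, ← mul_assoc, map_mul,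
      map_mul]
  simp only [pair, mul_add, add_mul, h₁, h₂, map_add, map_mul]
  simp only [mul_assoc]
  abel

theorem a_eq_pair (m : ℤ) : (a m : Alg n F) = pair (mono m 0) 0 := by simp [pair, a_eq]

theorem b_one_eq_pair : (b 1 : Alg n F) = pair 0 1 := by simp [pair]

theorem b_two_eq_pair : (b 2 : Alg n F) = pair (mono 0 1) 0 := by simp [pair, b_two_eq]

theorem b_three_eq_pair : (b 3 : Alg n F) = pair 0 (mono 0 1) := by simp [pair, b_three_eq]

theorem pair_pow (x : BaseAlg n F) (k : ℕ) : pair x 0 ^ k = pair (x ^ k) 0 := by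
  simp [pair]

theorem mono_one_pow : (mono 1 0 : BaseAlg n F) ^ (2 * n) = 1 := by
  rw [mono_pow, ← mono_zero]
  exact mono_eq_mono (by simp) (by simp)

theorem twist_mono_one_pow : (twist (mono 1 0) : BaseAlg n F) ^ (2 * n) = 1 := by
  rw [← map_pow, mono_one_pow, map_one]

theorem mono_one_mul : (mono 1 0 * mono (-1) 0 : BaseAlg n F) = 1 := by
  rw [mono_mul, ← mono_zero]; rfl

theorem mono_z_mul : (mono 0 1 * mono 0 1 : BaseAlg n F) = 1 := by
  rw [mono_mul, ← mono_zero]; exact mono_congr_right _ (by simp)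

theorem twist_mono_one : (twist (mono 1 0) : BaseAlg n F) = mono (-1) 0 * mono 0 1 := by
  rw [twist_mono, mono_mul]; rfl

theorem twist_mono_neg_one : (twist (mono (-1) 0) : BaseAlg n F) = mono 1 0 * mono 0 1 := by
  rw [twist_mono, mono_mul]; exact mono_congr_right _ (by simp)

/-- Since σ is multiplicative, a^m z^j - σ(a^m z^j) = z^j (a^m - σ(a)^m), which a - σ(a) divides. -/
theorem dvd_of_mem_antiInv (hn : 1 ≤ n) (h2 : (2 : F) ≠ 0) {w : BaseAlg n F}
    (hw : w ∈ antiInv n F) : mono 1 0 - twist (mono 1 0) ∣ w := by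
  have := antiInv_le_of_skew_mem h2
    ((Ideal.span {(mono 1 0 - twist (mono 1 0) : BaseAlg n F)}).restrictScalars F) (fun g => by
      obtain ⟨m, j, -, -, rfl⟩ := exists_elt_eq hn g
      rw [coe_skew_elt, Submodule.restrictScalars_mem, Ideal.mem_span_singleton]
      have e : (mono m j - mono (-m) (m + j) : BaseAlg n F) =
          mono 0 j * (mono 1 0 ^ m - twist (mono 1 0) ^ m) := by
        rw [twist_mono, mono_pow, mono_pow, mul_sub, mono_mul, mono_mul]
        congr 2 <;> ring
      rw [e]
      exact (sub_dvd_pow_sub_pow _ _ _).mul_left _) hw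
  rwa [Submodule.restrictScalars_mem, Ideal.mem_span_singleton] at this

theorem b_mul_add_mul_b (x y : BaseAlg n F) :
    b 1 * pair x y + pair x y * b 1 = pair ((twist y + y) * mono 0 1) (twist x + x) := by
  rw [b_one_eq_pair, pair_mul, pair_mul, pair_add, pair_eq_pair]
  constructor
  · simp; ring
  · simp

/-- The left side is the Leibniz expansion of d(baba). In normal form u₀, v₁ and u₁, v₀ separate
into the two components. -/
theorem relator_derivative (u₀ u₁ v₀ v₁ : BaseAlg n F) :
    pair v₀ v₁ * a 1 * b 1 * a 1 + b 1 * pair u₀ u₁ * b 1 * a 1 + b 1 * a 1 * pair v₀ v₁ * a 1 +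
      b 1 * a 1 * b 1 * pair u₀ u₁ =
    pair (v₁ + twist v₁ + (mono 1 0 * mono 0 1 * twist u₀ + mono (-1) 0 * u₀))
      (mono (-1) 0 * (mono 1 0 * mono 0 1 * v₀ + mono (-1) 0 * twist v₀ + twist u₁ + u₁)) := by
  rw [b_one_eq_pair, a_eq_pair]
  simp only [pair_mul, pair_add, pair_eq_pair, map_zero, map_one, twist_mono_one,
    mul_zero, zero_mul, add_zero, zero_add, one_mul,
    mul_one]
  have h := mono_one_mul (n := n) (F := F)
  have h' := mono_z_mul (n := n) (F := F)
  generalize (mono 1 0 : BaseAlg n F) = x at *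
  generalize (mono (-1) 0 : BaseAlg n F) = y at *
  generalize (mono 0 1 : BaseAlg n F) = z at *
  constructor
  · linear_combination (v₁ + twist v₁) * (z * z * h + h') + y * u₀ * h'
  · linear_combination (y * twist u₁ + y ^ 2 * twist v₀ + y * u₁) * h'

open TrivSqZeroExt in
-- Moving b past powers of a twists them, so the b-component collects the geometric sum g of the
-- products a^i σ(a)^(k-1-i). The other component lies in a commutative ring and obeys the usual
-- power rule.
theorem dual_pow (w u₁ : BaseAlg n F) (k : ℕ) : ∃ g : BaseAlg n F,
    (mono 1 0 - twist (mono 1 0)) * g = mono 1 0 ^ k - twist (mono 1 0) ^ k ∧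
    (inl (a 1) + inr (pair (mono 1 0 * w) u₁) : DualNumber (Alg n F)) ^ k =
      inl (pair (mono 1 0 ^ k) 0) + inr (pair ((k : BaseAlg n F) * w * mono 1 0 ^ k) (u₁ * g)) := by
  induction k with
  | zero => exact ⟨0, by simp, by simp [pair_one, pair_zero]⟩
  | succ k ih =>
    obtain ⟨g, hg, h⟩ := ih
    refine ⟨mono 1 0 ^ k + g * twist (mono 1 0), ?_, ?_⟩
    · linear_combination twist (mono 1 0) * hg
    · rw [pow_succ, h]
      refine TrivSqZeroExt.ext ?_ ?_
      · simp [a_eq_pair, pair_mul, pow_succ]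
      · simp only [snd_mul, fst_add, fst_inl, fst_inr, snd_add, snd_inl, snd_inr, add_zero, zero_add,
          smul_eq_mul, MulOpposite.smul_eq_mul_unop, MulOpposite.unop_op, a_eq_pair, pair_mul,
          pair_add, pair_eq_pair, map_zero, zero_mul, mul_zero]
        push_cast
        constructor <;> ring

/-- The values of derivations on the generators. -/
theorem exists_der_iff (hn : 1 ≤ n) (h2 : (2 : F) ≠ 0) (u₀ u₁ v₀ v₁ : BaseAlg n F) :
    (∃ d : Der F (Alg n F), values d = (pair u₀ u₁, pair v₀ v₁)) ↔
      v₁ ∈ antiInv n F ∧ v₀ ∈ antiInv n F ∧ mono (-1) 0 * u₀ ∈ antiInv n F ∧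
        u₁ - mono (-1) 0 * v₀ ∈ antiInv n F ∧ (n : F) • u₀ = 0 := by
  have hx := mono_one_mul (n := n) (F := F)
  have hz := mono_z_mul (n := n) (F := F)
  have htwo {x : BaseAlg n F} (h : x + x = 0) : x = 0 := by
    rw [← two_smul F x] at h
    exact (smul_eq_zero.mp h).resolve_left h2
  have hn' (x : BaseAlg n F) : (n : F) • x = n * x := by
    rw [Algebra.smul_def, map_natCast]
  simp only [mem_antiInv, map_mul, map_sub, twist_mono_neg_one, hn']
  constructor
  · rintro ⟨d, hd⟩
    have hda : d.1 (a 1) = pair u₀ u₁ := congrArg Prod.fst hd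
    have hdb : d.1 (b 1) = pair v₀ v₁ := congrArg Prod.snd hd
    -- Since b² is central with square 1, 0 = d(b² b²) = 2 b² d(b²), whence d(b²) = 0.
    have hs : pair ((twist v₁ + v₁) * mono 0 1) (twist v₀ + v₀) = 0 := by
      have h₁ : d.1 (b 2) = pair ((twist v₁ + v₁) * mono 0 1) (twist v₀ + v₀) := by
        rw [← b_mul_add_mul_b, b_two_eq, ← b_one_mul_b_one, der_mul, hdb, add_comm]
      have h₂ : (b 2 * b 2 : Alg n F) = 1 := by
        rw [b_two_eq_pair, pair_mul, ← pair_one]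
        simp [hz]
      have h₃ := der_one d
      rw [← h₂, der_mul, ← b_two_comm, ← mul_add, ← two_smul F (d.1 (b 2)), mul_smul_comm,
        smul_eq_zero, or_iff_right h2] at h₃
      have := congrArg (b 2 * ·) h₃
      simpa [← mul_assoc, h₂, h₁] using this
    obtain ⟨hv₁, hv₀⟩ := pair_eq_zero.mp hs
    replace hv₁ : twist v₁ + v₁ = 0 := by linear_combination mono 0 1 * hv₁ - (twist v₁ + v₁) * hz
    have hr : b 1 * a 1 * b 1 * a 1 = (1 : Alg n F) := by
      rw [b_one_eq_pair, a_eq_pair, ← pair_one]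
      simp only [pair_mul, pair_eq_pair, map_zero, map_one, twist_mono_one,
        mul_zero, zero_mul, add_zero, zero_add, one_mul]
      exact ⟨by linear_combination hz * mono 1 0 * mono (-1) 0 + hx, trivial⟩
    have hd' := der_one d
    rw [← hr, der_mul, der_mul, der_mul, hda, hdb] at hd'
    obtain ⟨hP, hQ⟩ := pair_eq_zero.mp <| (relator_derivative u₀ u₁ v₀ v₁).symm.trans <|
      (by noncomm_ring : _ = _).trans hd'
    refine ⟨by linear_combination hv₁, by linear_combination hv₀, ?_, ?_, ?_⟩
    · linear_combination hP - hv₁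
    · linear_combination mono 1 0 * hQ - (mono 1 0 * mono 0 1 * v₀ + mono (-1) 0 * twist v₀ +
        twist u₁ + u₁) * hx - (mono 1 0 * mono 0 1 + mono (-1) 0) * hv₀
    -- The extra factor a avoids the exponent k - 1 of the power rule. Only the component without b
    -- is needed: at k = 2n it gives 2n u₀ = 0.
    · have key (k : ℕ) : ∃ s, d.1 (a 1 ^ k) * a 1 = pair ((k : BaseAlg n F) * mono 1 0 ^ k * u₀) s := by
        induction k with
        | zero => exact ⟨0, by simp [der_one, pair_zero]⟩
        | succ k ih =>
          obtain ⟨s, hs⟩ := ih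
          rw [pow_succ, der_mul, add_mul, hs, hda, a_eq_pair, pair_pow, pair_mul, pair_mul,
            pair_mul, pair_add]
          refine ⟨_, pair_eq_pair.mpr ⟨?_, rfl⟩⟩
          simp only [map_zero, mul_zero, zero_mul, add_zero]
          push_cast
          ring
      obtain ⟨s, hs⟩ := key (2 * n)
      rw [a_eq_pair, pair_pow, mono_one_pow, pair_one, der_one, zero_mul, eq_comm,
        pair_eq_zero] at hs
      refine htwo ?_
      have := hs.1
      push_cast at this
      linear_combination this
  · rintro ⟨hv₁, hv₀, hu₀, hu₁, hn0⟩
    refine exists_der ?_ ?_ ?_ hn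
    · rw [b_mul_add_mul_b, pair_eq_zero, hv₁, hv₀]
      simp
    · rw [relator_derivative, pair_eq_zero]
      refine ⟨by linear_combination hv₁ + hu₀, ?_⟩
      linear_combination mono (-1) 0 * hu₁ + mono (-1) 0 * (mono 1 0 * mono 0 1 + mono (-1) 0) * hv₀
    · obtain ⟨g, hg, h⟩ := dual_pow (mono (-1) 0 * u₀) u₁ (2 * n)
      have e : mono 1 0 * (mono (-1) 0 * u₀) = u₀ := by linear_combination u₀ * hx
      rw [mono_one_pow, twist_mono_one_pow, sub_self] at hg
      -- As a^(2n) = 1, the geometric sum g is annihilated by a - σ(a). Both u₁ - a⁻¹v₀ and v₀ are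
      -- anti-invariant, so a - σ(a) divides u₁ and u₁ g = 0.
      obtain ⟨q, hq⟩ : mono 1 0 - twist (mono 1 0) ∣ u₁ := by
        have h₁ := dvd_of_mem_antiInv hn h2 (w := u₁ - mono (-1) 0 * v₀)
          (by rw [mem_antiInv, map_sub, map_mul, twist_mono_neg_one, hu₁])
        have h₂ := (dvd_of_mem_antiInv hn h2 (mem_antiInv.mpr hv₀)).mul_left (mono (-1) 0)
        simpa using dvd_add h₁ h₂
      rw [e, mono_one_pow, show u₁ * g = 0 by linear_combination g * hq + q * hg] at h
      rw [h, show ((2 * n : ℕ) : BaseAlg n F) * (mono (-1) 0 * u₀) * 1 = 0 by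
        push_cast; linear_combination 2 * mono (-1) 0 * hn0, pair_one, pair_zero]
      simp

end Characterization

/-! ### Parametrization of the derivations by anti-invariant elements -/

section Parametrization

variable {n : ℕ} {F : Type*} [Field F]

/-- `pair` as a linear map. -/
noncomputable def pairLin (n : ℕ) (F : Type*) [Field F] :
    BaseAlg n F × BaseAlg n F →ₗ[F] Alg n F where
  toFun x := pair x.1 x.2
  map_add' _ _ := (pair_add _ _ _ _).symm
  map_smul' c _ := (smul_pair c _ _).symm

/-- The pairs of values `(w b, 0)`. -/
noncomputable def valA (n : ℕ) (F : Type*) [Field F] : antiInv n F →ₗ[F] Alg n F × Alg n F :=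
  (pairLin n F ∘ₗ (0 : _ →ₗ[F] _).prod (antiInv n F).subtype).prod 0

/-- The pairs of values `(a⁻¹ w b, w)`. -/
noncomputable def valB (n : ℕ) (F : Type*) [Field F] : antiInv n F →ₗ[F] Alg n F × Alg n F :=
  (pairLin n F ∘ₗ (0 : _ →ₗ[F] _).prod
    (LinearMap.mulLeft F (mono (-1) 0) ∘ₗ (antiInv n F).subtype)).prod
    (pairLin n F ∘ₗ (antiInv n F).subtype.prod 0)

/-- The pairs of values `(0, w b)`. -/
noncomputable def valC (n : ℕ) (F : Type*) [Field F] : antiInv n F →ₗ[F] Alg n F × Alg n F :=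
  (0 : _ →ₗ[F] _).prod (pairLin n F ∘ₗ (0 : _ →ₗ[F] _).prod (antiInv n F).subtype)

/-- The pairs of values `(a w, 0)`. -/
noncomputable def valD (n : ℕ) (F : Type*) [Field F] : antiInv n F →ₗ[F] Alg n F × Alg n F :=
  (pairLin n F ∘ₗ (LinearMap.mulLeft F (mono 1 0) ∘ₗ (antiInv n F).subtype).prod 0).prod 0

theorem valA_apply (w : antiInv n F) : valA n F w = (pair 0 (w : BaseAlg n F), 0) := rfl

theorem valB_apply (w : antiInv n F) :
    valB n F w = (pair 0 (mono (-1) 0 * (w : BaseAlg n F)), pair (w : BaseAlg n F) 0) := rfl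

theorem valC_apply (w : antiInv n F) : valC n F w = (0, pair 0 (w : BaseAlg n F)) := rfl

theorem valD_apply (w : antiInv n F) :
    valD n F w = (pair (mono 1 0 * (w : BaseAlg n F)) 0, 0) := rfl

/-- The values of the derivations when `n` is invertible in `F`. -/
noncomputable def innerVal (n : ℕ) (F : Type*) [Field F] :
    antiInv n F × antiInv n F × antiInv n F →ₗ[F] Alg n F × Alg n F :=
  (valA n F).coprod ((valB n F).coprod (valC n F))

/-- The values of the derivations when `n` vanishes in `F`. -/
noncomputable def outerVal (n : ℕ) (F : Type*) [Field F] :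
    antiInv n F × antiInv n F × antiInv n F × antiInv n F →ₗ[F] Alg n F × Alg n F :=
  (valA n F).coprod ((valB n F).coprod ((valC n F + valD n F).coprod (valD n F)))

theorem innerVal_apply (w₁ w₂ w₃ : antiInv n F) :
    innerVal n F (w₁, w₂, w₃) =
      (pair 0 ((w₁ : BaseAlg n F) + mono (-1) 0 * (w₂ : BaseAlg n F)), pair (w₂ : BaseAlg n F) w₃) := by
  simp only [innerVal, LinearMap.coprod_apply, valA_apply, valB_apply, valC_apply, Prod.mk_add_mk,
    ← pair_zero, pair_add, zero_add, add_zero]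

theorem outerVal_apply (w₁ w₂ w₃ w₄ : antiInv n F) :
    outerVal n F (w₁, w₂, w₃, w₄) =
      (pair (mono 1 0 * ((w₃ : BaseAlg n F) + (w₄ : BaseAlg n F)))
        ((w₁ : BaseAlg n F) + mono (-1) 0 * (w₂ : BaseAlg n F)),
        pair (w₂ : BaseAlg n F) w₃) := by
  simp only [outerVal, LinearMap.coprod_apply, LinearMap.add_apply, valA_apply, valB_apply,
    valC_apply, valD_apply, Prod.mk_add_mk, ← pair_zero, pair_add, zero_add, add_zero, mul_add]

theorem innerVal_injective : Function.Injective (innerVal n F) := by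
  rw [injective_iff_map_eq_zero]
  rintro ⟨w₁, w₂, w₃⟩ h
  rw [innerVal_apply, Prod.mk_eq_zero, pair_eq_zero, pair_eq_zero] at h
  obtain ⟨⟨-, h₁⟩, h₂, h₃⟩ := h
  rw [h₂, mul_zero, add_zero] at h₁
  simp only [Prod.mk_eq_zero]
  exact ⟨Subtype.ext h₁, Subtype.ext h₂, Subtype.ext h₃⟩

theorem outerVal_injective : Function.Injective (outerVal n F) := by
  rw [injective_iff_map_eq_zero]
  rintro ⟨w₁, w₂, w₃, w₄⟩ h
  rw [outerVal_apply, Prod.mk_eq_zero, pair_eq_zero, pair_eq_zero] at h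
  obtain ⟨⟨h₄, h₁⟩, h₂, h₃⟩ := h
  rw [h₂, mul_zero, add_zero] at h₁
  rw [h₃, zero_add] at h₄
  simp only [Prod.mk_eq_zero]
  refine ⟨Subtype.ext h₁, Subtype.ext h₂, Subtype.ext h₃, Subtype.ext ?_⟩
  change (w₄ : BaseAlg n F) = 0
  linear_combination mono (-1) 0 * h₄ - (w₄ : BaseAlg n F) * mono_one_mul (n := n) (F := F)

theorem mem_range_valuesLin {u v : Alg n F} :
    (u, v) ∈ LinearMap.range (valuesLin n F) ↔ ∃ d : Der F (Alg n F), values d = (u, v) := Iff.rfl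

theorem range_innerVal (hn : 1 ≤ n) (h2 : (2 : F) ≠ 0) (hnF : (n : F) ≠ 0) :
    LinearMap.range (innerVal n F) = LinearMap.range (valuesLin n F) := by
  ext ⟨u, v⟩
  obtain ⟨u₀, u₁, rfl⟩ := exists_pair u
  obtain ⟨v₀, v₁, rfl⟩ := exists_pair v
  rw [mem_range_valuesLin, exists_der_iff hn h2, smul_eq_zero, or_iff_right hnF]
  constructor
  · rintro ⟨⟨w₁, w₂, w₃⟩, h⟩
    rw [innerVal_apply, Prod.mk.injEq, pair_eq_pair, pair_eq_pair] at h
    obtain ⟨⟨rfl, rfl⟩, rfl, rfl⟩ := h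
    refine ⟨w₃.2, w₂.2, by simp, by simp, rfl⟩
  · rintro ⟨h₃, h₂, -, h₁, rfl⟩
    exact ⟨(⟨_, h₁⟩, ⟨_, h₂⟩, ⟨_, h₃⟩), by rw [innerVal_apply]; simp⟩

theorem range_outerVal (hn : 1 ≤ n) (h2 : (2 : F) ≠ 0) (hnF : (n : F) = 0) :
    LinearMap.range (outerVal n F) = LinearMap.range (valuesLin n F) := by
  have hx := mono_one_mul (n := n) (F := F)
  ext ⟨u, v⟩
  obtain ⟨u₀, u₁, rfl⟩ := exists_pair u
  obtain ⟨v₀, v₁, rfl⟩ := exists_pair v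
  rw [mem_range_valuesLin, exists_der_iff hn h2]
  constructor
  · rintro ⟨⟨w₁, w₂, w₃, w₄⟩, h⟩
    rw [outerVal_apply, Prod.mk.injEq, pair_eq_pair, pair_eq_pair] at h
    obtain ⟨⟨rfl, rfl⟩, rfl, rfl⟩ := h
    refine ⟨w₃.2, w₂.2, ?_, by simp, by simp [hnF]⟩
    rw [← mul_assoc, mul_comm (mono (-1) 0), hx, one_mul]
    exact (w₃ + w₄).2
  · rintro ⟨h₃, h₂, h₄, h₁, -⟩
    -- The third family (a w, w b) already contributes a v₁ to u₀, so the last coordinate is a⁻¹u₀ -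
    -- v₁.
    refine ⟨(⟨_, h₁⟩, ⟨_, h₂⟩, ⟨_, h₃⟩, ⟨_, h₄⟩ - ⟨_, h₃⟩), ?_⟩
    rw [outerVal_apply, Prod.mk.injEq, pair_eq_pair, pair_eq_pair]
    refine ⟨⟨?_, by simp⟩, rfl, rfl⟩
    simp [← mul_assoc, hx]

/-- A parametrization of the values of derivations identifies the space of derivations. -/
noncomputable def derEquiv {V : Type*} [AddCommGroup V] [Module F V]
    (f : V →ₗ[F] Alg n F × Alg n F) (hf : Function.Injective f)
    (hr : LinearMap.range f = LinearMap.range (valuesLin n F)) : V ≃ₗ[F] Der F (Alg n F) :=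
  (LinearEquiv.ofInjective f hf).trans ((LinearEquiv.ofEq _ _ hr).trans
    (LinearEquiv.ofInjective _ valuesLin_injective).symm)

theorem values_derEquiv {V : Type*} [AddCommGroup V] [Module F V]
    (f : V →ₗ[F] Alg n F × Alg n F) (hf : Function.Injective f)
    (hr : LinearMap.range f = LinearMap.range (valuesLin n F)) (v : V) :
    values (derEquiv f hf hr v) = f v := by
  have h : LinearEquiv.ofInjective _ valuesLin_injective (derEquiv f hf hr v) =
      LinearEquiv.ofEq _ _ hr (LinearEquiv.ofInjective f hf v) := by simp [derEquiv]
  exact congrArg Subtype.val h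

/-- Because values determine a derivation, the derivations with values in S are exactly the images
of the basis vectors. -/
theorem isDerBasis_of_basis {V : Type*} [AddCommGroup V] [Module F V]
    {f : V →ₗ[F] Alg n F × Alg n F} (hf : Function.Injective f)
    (hr : LinearMap.range f = LinearMap.range (valuesLin n F)) {I : Type*}
    (B : Module.Basis I F V) {S : Set (Alg n F × Alg n F)}
    (hS : S = Set.range fun i => f (B i)) : IsDerBasis S := by
  have hD : derSet S = Set.range (B.map (derEquiv f hf hr)) := by
    ext d
    rw [derSet, Set.mem_ofPred_eq, hS, Set.mem_range, Set.mem_range]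
    refine exists_congr fun i => ?_
    rw [Module.Basis.map_apply, ← values_derEquiv f hf hr, values_injective.eq_iff]
  refine ⟨?_, ?_, ?_⟩
  · rw [hS]
    rintro _ ⟨i, rfl⟩
    exact ⟨derEquiv f hf hr (B i), values_derEquiv f hf hr _, fun d hd =>
      values_injective (hd.trans (values_derEquiv f hf hr _).symm)⟩
  · rw [hD]
    exact (B.map (derEquiv f hf hr)).linearIndependent.linearIndepOn_id
  · rw [hD]
    exact (B.map (derEquiv f hf hr)).span_eq

theorem range_prod_basis {V W : Type*} [AddCommGroup V] [Module F V] [AddCommGroup W] [Module F W]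
    {E : Type*} [AddCommGroup E] [Module F E] (f : V →ₗ[F] E) (g : W →ₗ[F] E) {I J : Type*}
    (B : Module.Basis I F V) (C : Module.Basis J F W) :
    (Set.range fun i => f.coprod g (B.prod C i)) =
      (Set.range fun i => f (B i)) ∪ Set.range fun j => g (C j) := by
  ext x
  simp [Module.Basis.prod_apply]

end Parametrization

/-! ### Comparison with the explicit lists -/

section Lists

variable {n : ℕ} {F : Type*} [Field F]

/-- The exponent of b² counts modulo 2: conjugating an even power of a leaves no extra b², while an
odd power keeps one. This is the source of the two shapes of entries in the lists. -/
theorem coe_skew_even (k : ℕ) (j : ℤ) : (skew F (elt n (2 * k) j) : BaseAlg n F) =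
    mono (2 * k) j - mono (-(2 * k)) j := by
  rw [coe_skew_elt]
  congr 1
  exact mono_congr_right _ (by omega)

theorem coe_skew_neg_even (k : ℕ) (j : ℤ) : (skew F (elt n (-(2 * k)) j) : BaseAlg n F) =
    mono (-(2 * k)) j - mono (2 * k) j := by
  rw [coe_skew_elt, neg_neg]
  congr 1
  exact mono_congr_right _ (by omega)

theorem coe_skew_odd (k : ℕ) : (skew F (elt n (2 * k - 1) 0) : BaseAlg n F) =
    mono (2 * k - 1) 0 - mono (-(2 * k - 1)) 1 := by
  rw [coe_skew_elt]
  congr 1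
  exact mono_congr_right _ (by omega)

theorem coe_skew_neg_odd (k : ℕ) : (skew F (elt n (-(2 * k - 1)) 0) : BaseAlg n F) =
    mono (-(2 * k - 1)) 0 - mono (2 * k - 1) 1 := by
  rw [coe_skew_elt, neg_neg]
  congr 1
  exact mono_congr_right _ (by omega)

theorem a_sub_a (i j : ℤ) : (a i - a j : Alg n F) = pair (mono i 0 - mono j 0) 0 := by
  simp [pair, a_eq]

theorem a_sub_a_mul_b_one (i j : ℤ) :
    (a i - a j : Alg n F) * b 1 = pair 0 (mono i 0 - mono j 0) := by
  simp [pair, a_eq]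

theorem a_sub_a_mul_b_two (i j : ℤ) :
    (a i - a j : Alg n F) * b 2 = pair (mono i 1 - mono j 1) 0 := by
  rw [a_sub_a, b_two_eq_pair, pair_mul]
  simp [sub_mul, mono_mul]

theorem a_sub_a_mul_b_three (i j : ℤ) :
    (a i - a j : Alg n F) * b 3 = pair 0 (mono i 1 - mono j 1) := by
  rw [a_sub_a, b_three_eq_pair, pair_mul]
  simp [sub_mul, mono_mul]

theorem a_sub_a_b_two (i j : ℤ) :
    (a i - a j * b 2 : Alg n F) = pair (mono i 0 - mono j 1) 0 := by
  rw [a_eq_pair, a_eq_pair, b_two_eq_pair, pair_mul, pair_sub]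
  simp [mono_mul]

theorem a_sub_a_b_two_mul_b_one (i j : ℤ) :
    (a i - a j * b 2 : Alg n F) * b 1 = pair 0 (mono i 0 - mono j 1) := by
  rw [a_sub_a_b_two, b_one_eq_pair, pair_mul]
  simp

theorem mem_range_valA_oddRep (s : Alg n F × Alg n F) :
    (s ∈ Set.range fun i => valA n F (skew F (oddRep n i))) ↔
      (∃ k ∈ Finset.Icc 1 ((n - 1) / 2), s =
        ((a (-(2 * k)) - a (2 * k)) * b 1, 0)) ∨
      (∃ k ∈ Finset.Icc 1 ((n - 1) / 2), s =
        ((a (-(2 * k)) - a (2 * k)) * b 3, 0)) ∨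
      (∃ k ∈ Finset.Icc 1 n, s =
        ((a (-(2 * k - 1)) - a (2 * k - 1) * b 2) * b 1, 0)) := by
  have h₁ (k : ℕ) : valA n F (skew F (elt n (-(2 * k)) 0)) =
      ((a (-(2 * k)) - a (2 * k)) * b 1, 0) := by
    rw [valA_apply, coe_skew_neg_even, a_sub_a_mul_b_one]
  have h₂ (k : ℕ) : valA n F (skew F (elt n (-(2 * k)) 1)) =
      ((a (-(2 * k)) - a (2 * k)) * b 3, 0) := by
    rw [valA_apply, coe_skew_neg_even, a_sub_a_mul_b_three]
  have h₃ (k : ℕ) : valA n F (skew F (elt n (-(2 * k - 1)) 0)) =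
      ((a (-(2 * k - 1)) - a (2 * k - 1) * b 2) * b 1, 0) := by
    rw [valA_apply, coe_skew_neg_odd, a_sub_a_b_two_mul_b_one]
  simp only [oddRep, Set.mem_range, Sum.exists, Subtype.exists, exists_prop, h₁, h₂, h₃,
    eq_comm (b := s)]

theorem mem_range_valB_smallRep (s : Alg n F × Alg n F) :
    (s ∈ Set.range fun i => valB n F (skew F (smallRep n i))) ↔
      (∃ k ∈ Finset.Icc 1 ((n - 1) / 2), s =
        ((a (2 * k - 1) - a (-(2 * k + 1))) * b 1, a (2 * k) - a (-(2 * k)))) ∨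
      (∃ k ∈ Finset.Icc 1 ((n - 1) / 2), s =
        ((a (2 * k - 1) - a (-(2 * k + 1))) * b 3, (a (2 * k) - a (-(2 * k))) * b 2)) ∨
      (∃ k ∈ Finset.Icc 1 ((n + 1) / 2), s =
        ((a (2 * k - 2) - a (-(2 * k)) * b 2) * b 1, a (2 * k - 1) - a (-(2 * k - 1)) * b 2)) ∨
      (∃ k ∈ Finset.Icc 1 (n / 2), s =
        ((a (-(2 * k)) - a (2 * k - 2) * b 2) * b 1, a (-(2 * k - 1)) - a (2 * k - 1) * b 2)) := by
  have h₁ (k : ℕ) : valB n F (skew F (elt n (2 * k) 0)) =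
      ((a (2 * k - 1) - a (-(2 * k + 1))) * b 1, a (2 * k) - a (-(2 * k))) := by
    rw [valB_apply, coe_skew_even, mul_sub, mono_mul, mono_mul, a_sub_a_mul_b_one, a_sub_a]
    ring_nf
  have h₂ (k : ℕ) : valB n F (skew F (elt n (2 * k) 1)) =
      ((a (2 * k - 1) - a (-(2 * k + 1))) * b 3, (a (2 * k) - a (-(2 * k))) * b 2) := by
    rw [valB_apply, coe_skew_even, mul_sub, mono_mul, mono_mul, a_sub_a_mul_b_three,
      a_sub_a_mul_b_two]
    ring_nf
  have h₃ (k : ℕ) : valB n F (skew F (elt n (2 * k - 1) 0)) =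
      ((a (2 * k - 2) - a (-(2 * k)) * b 2) * b 1, a (2 * k - 1) - a (-(2 * k - 1)) * b 2) := by
    rw [valB_apply, coe_skew_odd, mul_sub, mono_mul, mono_mul, a_sub_a_b_two_mul_b_one,
      a_sub_a_b_two]
    ring_nf
  have h₄ (k : ℕ) : valB n F (skew F (elt n (-(2 * k - 1)) 0)) =
      ((a (-(2 * k)) - a (2 * k - 2) * b 2) * b 1, a (-(2 * k - 1)) - a (2 * k - 1) * b 2) := by
    rw [valB_apply, coe_skew_neg_odd, mul_sub, mono_mul, mono_mul, a_sub_a_b_two_mul_b_one,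
      a_sub_a_b_two]
    ring_nf
  simp only [smallRep, Set.mem_range, Sum.exists, Subtype.exists, exists_prop, h₁, h₂, h₃, h₄,
    eq_comm (b := s)]

theorem mem_range_valC_smallRep (s : Alg n F × Alg n F) :
    (s ∈ Set.range fun i => valC n F (skew F (smallRep n i))) ↔
      (∃ k ∈ Finset.Icc 1 ((n - 1) / 2), s =
        (0, (a (2 * k) - a (-(2 * k))) * b 1)) ∨
      (∃ k ∈ Finset.Icc 1 ((n - 1) / 2), s =
        (0, (a (2 * k) - a (-(2 * k))) * b 3)) ∨
      (∃ k ∈ Finset.Icc 1 ((n + 1) / 2), s =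
        (0, (a (2 * k - 1) - a (-(2 * k - 1)) * b 2) * b 1)) ∨
      (∃ k ∈ Finset.Icc 1 (n / 2), s =
        (0, (a (-(2 * k - 1)) - a (2 * k - 1) * b 2) * b 1)) := by
  have h₁ (k : ℕ) : valC n F (skew F (elt n (2 * k) 0)) =
      (0, (a (2 * k) - a (-(2 * k))) * b 1) := by
    rw [valC_apply, coe_skew_even, a_sub_a_mul_b_one]
  have h₂ (k : ℕ) : valC n F (skew F (elt n (2 * k) 1)) =
      (0, (a (2 * k) - a (-(2 * k))) * b 3) := by
    rw [valC_apply, coe_skew_even, a_sub_a_mul_b_three]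
  have h₃ (k : ℕ) : valC n F (skew F (elt n (2 * k - 1) 0)) =
      (0, (a (2 * k - 1) - a (-(2 * k - 1)) * b 2) * b 1) := by
    rw [valC_apply, coe_skew_odd, a_sub_a_b_two_mul_b_one]
  have h₄ (k : ℕ) : valC n F (skew F (elt n (-(2 * k - 1)) 0)) =
      (0, (a (-(2 * k - 1)) - a (2 * k - 1) * b 2) * b 1) := by
    rw [valC_apply, coe_skew_neg_odd, a_sub_a_b_two_mul_b_one]
  simp only [smallRep, Set.mem_range, Sum.exists, Subtype.exists, exists_prop, h₁, h₂, h₃, h₄,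
    eq_comm (b := s)]

theorem mem_range_valC_add_valD_smallRep (s : Alg n F × Alg n F) :
    (s ∈ Set.range fun i => (valC n F + valD n F) (skew F (smallRep n i))) ↔
      (∃ k ∈ Finset.Icc 1 ((n - 1) / 2), s =
        (a (2 * k + 1) - a (-(2 * k - 1)), (a (2 * k) - a (-(2 * k))) * b 1)) ∨
      (∃ k ∈ Finset.Icc 1 ((n - 1) / 2), s =
        ((a (2 * k + 1) - a (-(2 * k - 1))) * b 2, (a (2 * k) - a (-(2 * k))) * b 3)) ∨
      (∃ k ∈ Finset.Icc 1 ((n + 1) / 2), s =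
        (a (2 * k) - a (-(2 * k - 2)) * b 2, (a (2 * k - 1) - a (-(2 * k - 1)) * b 2) * b 1)) ∨
      (∃ k ∈ Finset.Icc 1 (n / 2), s =
        (a (-(2 * k - 2)) - a (2 * k) * b 2, (a (-(2 * k - 1)) - a (2 * k - 1) * b 2) * b 1)) := by
  have h₁ (k : ℕ) : (valC n F + valD n F) (skew F (elt n (2 * k) 0)) =
      (a (2 * k + 1) - a (-(2 * k - 1)), (a (2 * k) - a (-(2 * k))) * b 1) := by
    rw [LinearMap.add_apply, valC_apply, valD_apply, Prod.mk_add_mk, zero_add, add_zero,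
      coe_skew_even, mul_sub, mono_mul, mono_mul, a_sub_a, a_sub_a_mul_b_one]
    ring_nf
  have h₂ (k : ℕ) : (valC n F + valD n F) (skew F (elt n (2 * k) 1)) =
      ((a (2 * k + 1) - a (-(2 * k - 1))) * b 2, (a (2 * k) - a (-(2 * k))) * b 3) := by
    rw [LinearMap.add_apply, valC_apply, valD_apply, Prod.mk_add_mk, zero_add, add_zero,
      coe_skew_even, mul_sub, mono_mul, mono_mul, a_sub_a_mul_b_two, a_sub_a_mul_b_three]
    ring_nf
  have h₃ (k : ℕ) : (valC n F + valD n F) (skew F (elt n (2 * k - 1) 0)) =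
      (a (2 * k) - a (-(2 * k - 2)) * b 2, (a (2 * k - 1) - a (-(2 * k - 1)) * b 2) * b 1) := by
    rw [LinearMap.add_apply, valC_apply, valD_apply, Prod.mk_add_mk, zero_add, add_zero,
      coe_skew_odd, mul_sub, mono_mul, mono_mul, a_sub_a_b_two, a_sub_a_b_two_mul_b_one]
    ring_nf
  have h₄ (k : ℕ) : (valC n F + valD n F) (skew F (elt n (-(2 * k - 1)) 0)) =
      (a (-(2 * k - 2)) - a (2 * k) * b 2, (a (-(2 * k - 1)) - a (2 * k - 1) * b 2) * b 1) := by
    rw [LinearMap.add_apply, valC_apply, valD_apply, Prod.mk_add_mk, zero_add, add_zero,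
      coe_skew_neg_odd, mul_sub, mono_mul, mono_mul, a_sub_a_b_two, a_sub_a_b_two_mul_b_one]
    ring_nf
  simp only [smallRep, Set.mem_range, Sum.exists, Subtype.exists, exists_prop, h₁, h₂, h₃, h₄,
    eq_comm (b := s)]

theorem mem_range_valD_oddRep (s : Alg n F × Alg n F) :
    (s ∈ Set.range fun i => valD n F (skew F (oddRep n i))) ↔
      (∃ k ∈ Finset.Icc 1 ((n - 1) / 2), s =
        (a (-(2 * k - 1)) - a (2 * k + 1), 0)) ∨
      (∃ k ∈ Finset.Icc 1 ((n - 1) / 2), s =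
        ((a (-(2 * k - 1)) - a (2 * k + 1)) * b 2, 0)) ∨
      (∃ k ∈ Finset.Icc 1 n, s =
        (a (-(2 * k - 2)) - a (2 * k) * b 2, 0)) := by
  have h₁ (k : ℕ) : valD n F (skew F (elt n (-(2 * k)) 0)) =
      (a (-(2 * k - 1)) - a (2 * k + 1), 0) := by
    rw [valD_apply, coe_skew_neg_even, mul_sub, mono_mul, mono_mul, a_sub_a]
    ring_nf
  have h₂ (k : ℕ) : valD n F (skew F (elt n (-(2 * k)) 1)) =
      ((a (-(2 * k - 1)) - a (2 * k + 1)) * b 2, 0) := by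
    rw [valD_apply, coe_skew_neg_even, mul_sub, mono_mul, mono_mul, a_sub_a_mul_b_two]
    ring_nf
  have h₃ (k : ℕ) : valD n F (skew F (elt n (-(2 * k - 1)) 0)) =
      (a (-(2 * k - 2)) - a (2 * k) * b 2, 0) := by
    rw [valD_apply, coe_skew_neg_odd, mul_sub, mono_mul, mono_mul, a_sub_a_b_two]
    ring_nf
  simp only [oddRep, Set.mem_range, Sum.exists, Subtype.exists, exists_prop, h₁, h₂, h₃,
    eq_comm (b := s)]

theorem lists_eq_range_innerVal (hn : 1 ≤ n) (h2 : (2 : F) ≠ 0) :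
    B₁ n F ∪ B₂ n F ∪ B₃ n F ∪ B₄ n F = Set.range fun i => innerVal n F
      ((oddBasis hn h2).prod ((smallBasis hn h2).prod (smallBasis hn h2)) i) := by
  simp only [innerVal, range_prod_basis, oddBasis_apply, smallBasis_apply]
  ext s
  simp only [Set.mem_union, mem_range_valA_oddRep, mem_range_valB_smallRep,
    mem_range_valC_smallRep]
  simp only [B₁, B₂, B₃, B₄, Set.mem_ofPred_eq, Set.mem_insert_iff,
    Set.mem_singleton_iff, and_or_left, exists_or]
  apply iff_of_eq
  -- The lists group the pairs by range of k and shape of exponent, the parametrization groups them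
  -- by family; the disjuncts are the same.
  ac_rfl

theorem lists_eq_range_outerVal (hn : 1 ≤ n) (h2 : (2 : F) ≠ 0) :
    B₁' n F ∪ B₂' n F ∪ B₃' n F ∪ B₄' n F = Set.range fun i => outerVal n F
      ((oddBasis hn h2).prod ((smallBasis hn h2).prod ((smallBasis hn h2).prod
        (oddBasis hn h2))) i) := by
  simp only [outerVal, range_prod_basis, oddBasis_apply, smallBasis_apply]
  ext s
  simp only [Set.mem_union,
    mem_range_valA_oddRep, mem_range_valB_smallRep, mem_range_valC_add_valD_smallRep,
    mem_range_valD_oddRep]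
  simp only [B₁', B₂', B₃', B₄', Set.mem_ofPred_eq, Set.mem_insert_iff,
    Set.mem_singleton_iff, and_or_left, exists_or]
  apply iff_of_eq
  ac_rfl

theorem two_ne_zero_of_charP {p : ℕ} [CharP F p] (hp : Odd p) : (2 : F) ≠ 0 := by
  intro h
  have h' : ((2 : ℕ) : F) = 0 := by exact_mod_cast h
  rw [CharP.cast_eq_zero_iff F p] at h'
  obtain h1 | h1 := (Nat.dvd_prime Nat.prime_two).mp h'
  · exact CharP.char_ne_one F p h1
  · rw [h1] at hp
    exact absurd hp (by decide)

end Lists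

end V8n

theorem theorem3p1 (n : ℕ) (hn : 1 ≤ n) (F : Type*) [Field F]
    (p : ℕ) (hp : p.Prime) (hp_odd : Odd p) :
    ((CharP F 0 ∨ (CharP F p ∧ Nat.gcd n p = 1)) →
      Module.Finite F (V8n.Der F (V8n.Alg n F)) ∧
      (Odd n → Module.finrank F (V8n.Der F (V8n.Alg n F)) = 3 * (2 * n - 1)) ∧
      (Even n → Module.finrank F (V8n.Der F (V8n.Alg n F)) = 6 * (n - 1)) ∧
      V8n.IsDerBasis (V8n.B₁ n F ∪ V8n.B₂ n F ∪ V8n.B₃ n F ∪ V8n.B₄ n F)) ∧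
    ((CharP F p ∧ Nat.gcd n p ≠ 1) →
      Module.Finite F (V8n.Der F (V8n.Alg n F)) ∧
      (Odd n → Module.finrank F (V8n.Der F (V8n.Alg n F)) = 4 * (2 * n - 1)) ∧
      (Even n → Module.finrank F (V8n.Der F (V8n.Alg n F)) = 8 * (n - 1)) ∧
      V8n.IsDerBasis (V8n.B₁' n F ∪ V8n.B₂' n F ∪ V8n.B₃' n F ∪ V8n.B₄' n F)) := by
  refine ⟨fun h => ?_, fun ⟨hc, hnp⟩ => ?_⟩
  -- The characteristic enters only through 2 ≠ 0 in F and the question whether n vanishes in F.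
  · obtain ⟨h2, hnF⟩ : (2 : F) ≠ 0 ∧ (n : F) ≠ 0 := by
      obtain h | ⟨h, hnp⟩ := h
      · have := CharP.charP_to_charZero F
        exact ⟨two_ne_zero, Nat.cast_ne_zero.mpr (by omega)⟩
      · refine ⟨V8n.two_ne_zero_of_charP hp_odd, fun h0 => ?_⟩
        rw [CharP.cast_eq_zero_iff F p] at h0
        rw [Nat.gcd_eq_right h0] at hnp
        exact hp.one_lt.ne' hnp
    let e := V8n.derEquiv (V8n.innerVal n F) V8n.innerVal_injective
      (V8n.range_innerVal hn h2 hnF)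
    have := Module.Finite.of_basis (V8n.oddBasis hn h2)
    have hd : Module.finrank F (V8n.Der F (V8n.Alg n F)) = 3 * (2 * ((n - 1) / 2) + n) := by
      rw [← e.finrank_eq, Module.finrank_prod, Module.finrank_prod, V8n.finrank_antiInv hn h2]
      ring
    refine ⟨Module.Finite.equiv e, fun hodd => ?_, fun heven => ?_,
      V8n.isDerBasis_of_basis V8n.innerVal_injective (V8n.range_innerVal hn h2 hnF) _
        (V8n.lists_eq_range_innerVal hn h2)⟩
    · obtain ⟨m, rfl⟩ := hodd
      omega
    · obtain ⟨m, rfl⟩ := heven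
      omega
  · have h2 : (2 : F) ≠ 0 := V8n.two_ne_zero_of_charP hp_odd
    have hnF : (n : F) = 0 := by
      rw [CharP.cast_eq_zero_iff F p]
      by_contra hpn
      exact hnp ((hp.coprime_iff_not_dvd.mpr hpn).symm)
    let e := V8n.derEquiv (V8n.outerVal n F) V8n.outerVal_injective
      (V8n.range_outerVal hn h2 hnF)
    have := Module.Finite.of_basis (V8n.oddBasis hn h2)
    have hd : Module.finrank F (V8n.Der F (V8n.Alg n F)) = 4 * (2 * ((n - 1) / 2) + n) := by
      rw [← e.finrank_eq, Module.finrank_prod, Module.finrank_prod, Module.finrank_prod,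
        V8n.finrank_antiInv hn h2]
      ring
    refine ⟨Module.Finite.equiv e, fun hodd => ?_, fun heven => ?_,
      V8n.isDerBasis_of_basis V8n.outerVal_injective (V8n.range_outerVal hn h2 hnF) _
        (V8n.lists_eq_range_outerVal hn h2)⟩
    · obtain ⟨m, rfl⟩ := hodd
      omega
    · obtain ⟨m, rfl⟩ := heven
      omega
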